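/- **Setting.** A *binary tree* is a finite set $T$ of finite words over $\{0,1\}$ that contains with each nonempty word $(u_1,\dots,u_m)$ also $(u_1,\dots,u_{m-1})$. For $s\in[0,1]$ let $(u_m)_{m\ge1}$ be its binary expansion (terminating for dyadic rationals $s<1$; $u_m=1$ for all $m$ if $s=1$), and let $X_s(T)=\min\{m\ge 0:(u_1,\dots,u_m)\notin T\}$ be the *silhouette* of $T$. Put $$Y_t(T)=\int_0^t X_s(T)\,ds,\quad Y^\circ_t(T)=Y_t(T)-t\,Y_1(T),\quad \eta(T)=Y_1(T),\quad \eta^\circ(T)=\eta(T)-H_{\#T},$$ with $H_n=\sum_{i=1}^n 1/i$. For $f:[0,1]\to\mathbb R$ let $\Delta_kf\in\mathbb R^{2^k}$ have the components $(\Delta_kf)_j=f(j2^{-k})-f((j-1)2^{-k})$, $j=1,\dots,2^k$. Let $T_n$ be the tree produced by the binary search tree algorithm from the first $n$ terms of a sequence of independent random variables, uniformly distributed on $[0,1]$ (a new value moves to the left, letter $0$, at nodes with a larger label and to the right, letter $1$, at nodes with a smaller label, until it finds an empty position, where it is stored). For $j=1,\dots,2^k$ let $u(k,j)=(u_1(k,j),\dots,u_k(k,j))$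 with $u_m(k,j)=\lfloor 2^{m-k}(j-1)\rfloor \bmod 2$ be the words of length $k$ in their natural order, $u(k,j,l)$ the prefix of $u(k,j)$ of length $l$, and $1_k$ the vector of length $2^k$ with all entries $1$. **Theorem.** (i) There is exactly one probability distribution on $\mathbb R$ with finite second moment and mean zero, denoted by $\mathcal L(\eta_\infty)$, such that $$\eta_\infty=_{\mathcal D}\tfrac12(\eta_\infty+\eta_\infty')+1+\tfrac12\bigl(\log\xi+\log(1-\xi)\bigr),$$ where $\eta_\infty,\eta'_\infty,\xi$ are independent, $\eta'_\infty=_{\mathcal D}\eta_\infty$ and $\xi$ is uniformly distributed on $[0,1]$. (ii) For every fixed $k\ge 0$, as $n\to\infty$, $$\begin{pmatrix}\Delta_kY^\circ(T_n)\\ \eta^\circ(T_n)\end{pmatrix}\to_{\mathcal D}\begin{pmatrix}2^{-k}(k1_k+\rho_k+\eta_k-\eta^\circ_\infty 1_k)\\ \eta^\circ_\infty\end{pmatrix}.$$ Here $\rho_k=(\rho_{k,1},\dots,\rho_{k,2^k})$ and $\eta_k=(\eta_{k,1},\dots,\eta_{k,2^k})$ are independent random vectors; the components of $\eta_k$ are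 independent, each with the distribution of $\eta_\infty$; the vector $\rho_k$ has the same (joint) distribution as the vector with the components $$\sum_{\{1\le l\le k:\,u_l(k,j)=1\}}\log\xi_{u(k,j,l-1)}+\sum_{\{1\le l\le k:\,u_l(k,j)=0\}}\log\bigl(1-\xi_{u(k,j,l-1)}\bigr),\qquad j=1,\dots,2^k,$$ where the $\xi_u$, for $u$ a finite word over $\{0,1\}$, are independent and uniformly distributed on $[0,1]$; and $$\eta^\circ_\infty=2^{-k}\sum_{j=1}^{2^k}\bigl(k+\rho_{k,j}+\eta_{k,j}\bigr).$$ -/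

import Mathlib

open MeasureTheory ProbabilityTheory Filter

noncomputable section

namespace Silhouette

/-- A rooted, directed binary tree: a finite, prefix-stable set of finite zero-one words
(the internal nodes); `false` is the letter `0` (left), `true` is the letter `1` (right). -/
structure BinTree where
  nodes : Finset (List Bool)
  prefix_mem : ∀ (u : List Bool) (b : Bool), u ++ [b] ∈ nodes → u ∈ nodes

/-- The set of nodes of a labeled binary tree, as zero-one words. -/
def nodeSet : BinaryTree ℝ → Finset (List Bool)
  | .nil => ∅
  | .node _ l r =>
      insert [] ((nodeSet l).image (List.cons false) ∪ (nodeSet r).image (List.cons true))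

theorem nodeSet_prefix (t : BinaryTree ℝ) :
    ∀ (u : List Bool) (b : Bool), u ++ [b] ∈ nodeSet t → u ∈ nodeSet t := by
  induction t with
  | nil => simp [nodeSet]
  | node a l r hl hr =>
    intro u b h
    cases u with
    | nil => simp [nodeSet]
    | cons c u =>
      simp only [nodeSet, Finset.mem_insert, Finset.mem_union, Finset.mem_image] at h ⊢
      rcases h with h | ⟨v, hv, h⟩ | ⟨v, hv, h⟩
      · simp at h
      · simp only [List.cons_append, List.cons.injEq] at h
        obtain ⟨rfl, rfl⟩ := h
        exact Or.inr (Or.inl ⟨u, hl u b hv, rfl⟩)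
      · simp only [List.cons_append, List.cons.injEq] at h
        obtain ⟨rfl, rfl⟩ := h
        exact Or.inr (Or.inr ⟨u, hr u b hv, rfl⟩)

/-- The binary tree underlying a labeled binary tree. -/
def shape (t : BinaryTree ℝ) : BinTree := ⟨nodeSet t, nodeSet_prefix t⟩

/-- One step of the binary search tree algorithm: starting at the root, move to the left if `x`
is smaller than the label of the current node and to the right otherwise, until an empty node is
found; attach that node with label `x`. (Ties have probability zero for the inputs of interest.) -/
def bstInsert (x : ℝ) : BinaryTree ℝ → BinaryTree ℝ
  | .nil => .node x .nil .nil
  | .node a l r => if x < a then .node a (bstInsert x l) r else .node a l (bstInsert x r)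

/-- The labeled tree generated from the first `n` terms `x 0, …, x (n - 1)` of the input. -/
def bstLabeled (x : ℕ → ℝ) : ℕ → BinaryTree ℝ
  | 0 => .nil
  | n + 1 => bstInsert (x n) (bstLabeled x n)

/-- The binary tree `T_n` generated from the first `n` terms of the input. -/
def bst (x : ℕ → ℝ) (n : ℕ) : BinTree := shape (bstLabeled x n)

/-- The digit `u_m`, `m ≥ 1`, of the binary expansion of `s ∈ [0, 1]`: binary rationals `s < 1`
have the terminating expansion, and `1 = 0.111…`. -/
def binDigit (s : ℝ) (m : ℕ) : Bool :=
  if s = 1 then true else decide (⌊(2 : ℝ) ^ m * s⌋ % 2 = 1)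

/-- The word `(u_1, …, u_k)` of the first `k` binary digits of `s`. -/
def binPrefix (s : ℝ) (k : ℕ) : List Bool :=
  List.ofFn fun i : Fin k => binDigit s (i + 1)

/-- The silhouette `X_s(T) = min {k : (u_1, …, u_k) ∉ T}`. -/
def silhouette (T : BinTree) (s : ℝ) : ℕ :=
  sInf {k : ℕ | binPrefix s k ∉ T.nodes}

/-- The integrated silhouette `Y_t(T)`. -/
def intSilhouette (T : BinTree) (t : ℝ) : ℝ :=
  ∫ s in (0 : ℝ)..t, (silhouette T s : ℝ)

/-- The normalized integrated silhouette `Y°_t(T) = Y_t(T) - t Y_1(T)`. -/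
def normSilhouette (T : BinTree) (t : ℝ) : ℝ :=
  intSilhouette T t - t * intSilhouette T 1

/-- The discounted external path length `η(T) = ∫_0^1 X_s(T) ds`. -/
def pathLength (T : BinTree) : ℝ := ∫ s in (0 : ℝ)..1, (silhouette T s : ℝ)

/-- The centered path length `η°(T) = η(T) - H(#T)`, with `H` the harmonic numbers. -/
def centeredPathLength (T : BinTree) : ℝ :=
  pathLength T - ((harmonic T.nodes.card : ℚ) : ℝ)

/-- The increments of `f` over the dyadic intervals of depth `k`, listed from `0`:
the entry with index `j` belongs to `[j 2^(-k), (j + 1) 2^(-k)]`. -/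
def dyadicIncr (k : ℕ) (f : ℝ → ℝ) (j : Fin (2 ^ k)) : ℝ :=
  f (((j : ℕ) + 1 : ℝ) / 2 ^ k) - f (((j : ℕ) : ℝ) / 2 ^ k)

/-- The letter at position `l` (counted from `0`) of the node of depth `k` with index `j`
(counted from `0`) in the order of the associated binary rationals. -/
def dyadicLetter (k : ℕ) (j : Fin (2 ^ k)) (l : ℕ) : Bool :=
  decide (((j : ℕ) / 2 ^ (k - (l + 1))) % 2 = 1)

/-- The ancestor at depth `l` of the node of depth `k` with index `j`. -/
def dyadicAncestor (k : ℕ) (j : Fin (2 ^ k)) (l : ℕ) : List Bool :=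
  List.ofFn fun i : Fin l => dyadicLetter k j i

/-- The sum along the path to the node of depth `k` with index `j` of the terms `log ξ_u` (where
the path turns right at `u`) and `log (1 - ξ_u)` (where the path turns left at `u`). -/
def pathLogSum (k : ℕ) (ξ : List Bool → ℝ) (j : Fin (2 ^ k)) : ℝ :=
  ∑ l : Fin k, if dyadicLetter k j l = true
    then Real.log (ξ (dyadicAncestor k j l))
    else Real.log (1 - ξ (dyadicAncestor k j l))

/-- The uniform distribution on the unit interval. -/
def unif : Measure ℝ := volume.restrict (Set.Icc 0 1)

/-- `ν` is a centered probability distribution on the line with finite second moment that solves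
`η =_D (η + η') / 2 + 1 + (log ξ + log (1 - ξ)) / 2` with `η, η'` of law `ν`, `ξ` uniform on the
unit interval, and `η, η', ξ` independent. -/
structure IsEtaLaw (ν : Measure ℝ) : Prop where
  isProbabilityMeasure : IsProbabilityMeasure ν
  memLp : MemLp (fun x : ℝ => x) 2 ν
  mean_zero : ∫ x, x ∂ν = 0
  fixed : ((ν.prod ν).prod unif).map (fun p : (ℝ × ℝ) × ℝ =>
    (p.1.1 + p.1.2) / 2 + (1 + (Real.log p.2 + Real.log (1 - p.2)) / 2)) = ν

/-- The limit `η°_∞ = 2^(-k) ∑_j (k + ρ_{k,j} + η_{k,j})` of the centered path lengths. -/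
def etaLimit (k : ℕ) (ρ η : Fin (2 ^ k) → ℝ) : ℝ :=
  (∑ j, ((k : ℝ) + ρ j + η j)) / 2 ^ k

/-- The limit `2^(-k) (k 1_k + ρ_k + η_k - η°_∞)` of the dyadic increments. -/
def incrLimit (k : ℕ) (ρ η : Fin (2 ^ k) → ℝ) (j : Fin (2 ^ k)) : ℝ :=
  ((k : ℝ) + ρ j + η j - etaLimit k ρ η) / 2 ^ k

end Silhouette

end

namespace Silhouette

open scoped Topology

/-! ### Path lengths of trees -/

section PathLength

variable {α β : Type*}

/-- The discounted external path length of a tree, computed recursively. -/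
noncomputable def extPath : BinaryTree α → ℝ
  | .nil => 0
  | .node _ l r => 1 + (extPath l + extPath r) / 2

/-- The mean of the silhouette over the dyadic interval that belongs to a word. -/
noncomputable def localPath : List Bool → BinaryTree α → ℝ
  | [], t => extPath t
  | _ :: _, .nil => 0
  | b :: u, .node _ l r => 1 + localPath u (if b then r else l)

theorem extPath_map (f : α → β) (t : BinaryTree α) : extPath (t.map f) = extPath t := by
  induction t with
  | nil => rfl
  | node a l r hl hr => simp [BinaryTree.map, extPath, hl, hr]

theorem localPath_map (f : α → β) (u : List Bool) (t : BinaryTree α) :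
    localPath u (t.map f) = localPath u t := by
  induction u generalizing t with
  | nil => exact extPath_map f t
  | cons b u ih =>
    cases t with
    | nil => rfl
    | node a l r => cases b <;> simp [BinaryTree.map, localPath, ih]

theorem numNodes_map (f : α → β) (t : BinaryTree α) : (t.map f).numNodes = t.numNodes := by
  induction t with
  | nil => rfl
  | node a l r hl hr => simp [BinaryTree.map, hl, hr]

end PathLength

theorem card_nodeSet (t : BinaryTree ℝ) : (nodeSet t).card = t.numNodes := by
  induction t with
  | nil => rfl
  | node a l r hl hr =>
    rw [nodeSet, Finset.card_insert_of_notMem (by simp), Finset.card_union_of_disjoint,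
      Finset.card_image_of_injective _ List.cons_injective,
      Finset.card_image_of_injective _ List.cons_injective, hl, hr, BinaryTree.numNodes]
    rw [Finset.disjoint_left]
    simp only [Finset.mem_image]
    rintro _ ⟨u, -, rfl⟩ ⟨v, -, hv⟩
    simp at hv

/-! ### The silhouette of a tree in terms of its subtrees -/

theorem binPrefix_succ (s : ℝ) (k : ℕ) :
    binPrefix s (k + 1) = binDigit s 1 :: List.ofFn fun i : Fin k => binDigit s (i + 2) := by
  simp [binPrefix, List.ofFn_succ, add_assoc]

theorem exists_binPrefix_notMem (T : BinTree) (s : ℝ) : ∃ k, binPrefix s k ∉ T.nodes := by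
  by_contra! h
  have hinj : Function.Injective (binPrefix s) := fun a b hab => by
    simpa [binPrefix] using congrArg List.length hab
  exact Set.infinite_of_injective_forall_mem hinj h T.nodes.finite_toSet

theorem silhouette_nil (s : ℝ) : silhouette (shape .nil) s = 0 := by
  simp [silhouette, shape, nodeSet]

theorem silhouette_node (a : ℝ) (l r : BinaryTree ℝ) (s s' : ℝ) (b : Bool)
    (h1 : binDigit s 1 = b) (h2 : ∀ m, binDigit s (m + 2) = binDigit s' (m + 1)) :
    silhouette (shape (.node a l r)) s = silhouette (shape (if b then r else l)) s' + 1 := by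
  have key : ∀ k, binPrefix s (k + 1) ∉ (shape (.node a l r)).nodes ↔
      binPrefix s' k ∉ (shape (if b then r else l)).nodes := by
    intro k
    have : binPrefix s (k + 1) = b :: binPrefix s' k := by
      rw [binPrefix_succ, h1]
      simp [binPrefix, h2]
    rw [this]
    cases b <;> simp [shape, nodeSet]
  have h0 : binPrefix s 0 ∈ (shape (.node a l r)).nodes := by simp [binPrefix, shape, nodeSet]
  have hne := exists_binPrefix_notMem (shape (if b then r else l)) s'
  rw [silhouette, silhouette]
  refine le_antisymm (Nat.sInf_le ?_) ?_
  · exact (key _).2 (Nat.sInf_mem hne)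
  · have hmem : sInf {k | binPrefix s k ∉ (shape (.node a l r)).nodes} ∈
        {k | binPrefix s k ∉ (shape (.node a l r)).nodes} :=
      Nat.sInf_mem (exists_binPrefix_notMem (shape (.node a l r)) s)
    obtain ⟨m, hm⟩ : ∃ m, sInf {k | binPrefix s k ∉ (shape (.node a l r)).nodes} = m + 1 := by
      refine Nat.exists_eq_succ_of_ne_zero fun h => ?_
      rw [h] at hmem
      exact hmem h0
    rw [hm] at hmem ⊢
    exact Nat.succ_le_succ (Nat.sInf_le ((key m).1 hmem))

theorem silhouette_node_left (a : ℝ) (l r : BinaryTree ℝ) {s : ℝ} (h0 : 0 ≤ s) (h1 : s < 1 / 2) :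
    silhouette (shape (.node a l r)) s = silhouette (shape l) (2 * s) + 1 := by
  refine silhouette_node a l r s (2 * s) false ?_ fun m => ?_
  · have : ⌊(2 : ℝ) ^ 1 * s⌋ = 0 := by rw [Int.floor_eq_iff]; constructor <;> norm_num <;> linarith
    simp only [binDigit, this]
    rw [if_neg (by linarith)]
    simp
  · rw [binDigit, binDigit, if_neg (by linarith), if_neg (by linarith)]
    congr 4
    ring_nf

theorem silhouette_node_right (a : ℝ) (l r : BinaryTree ℝ) {s : ℝ} (h0 : 1 / 2 ≤ s) (h1 : s < 1) :
    silhouette (shape (.node a l r)) s = silhouette (shape r) (2 * s - 1) + 1 := by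
  refine silhouette_node a l r s (2 * s - 1) true ?_ fun m => ?_
  · have : ⌊(2 : ℝ) ^ 1 * s⌋ = 1 := by rw [Int.floor_eq_iff]; constructor <;> norm_num <;> linarith
    simp only [binDigit, this]
    rw [if_neg (by linarith)]
    simp
  · rw [binDigit, binDigit, if_neg (by linarith), if_neg (by linarith)]
    have : (2 : ℝ) ^ (m + 1) * (2 * s - 1) = 2 ^ (m + 2) * s - ((2 ^ (m + 1) : ℤ) : ℝ) := by
      push_cast; ring
    rw [this, Int.floor_sub_intCast, pow_succ]
    congr 1
    rw [eq_iff_iff]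
    omega

/-! ### Integrals of the silhouette -/

theorem intervalIntegral_silhouette_node_left (a : ℝ) (l r : BinaryTree ℝ) {c d : ℝ}
    (hc : 0 ≤ c) (hcd : c ≤ d) (hd : d ≤ 1 / 2)
    (hl : IntervalIntegrable (fun s => (silhouette (shape l) s : ℝ)) volume (2 * c) (2 * d)) :
    IntervalIntegrable (fun s => (silhouette (shape (.node a l r)) s : ℝ)) volume c d ∧
    ∫ s in c..d, (silhouette (shape (.node a l r)) s : ℝ) =
      (d - c) + (∫ s in (2 * c)..(2 * d), (silhouette (shape l) s : ℝ)) / 2 := by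
  have hl' : IntervalIntegrable (fun s => (silhouette (shape l) (2 * s) : ℝ)) volume c d := by
    simpa using hl.comp_mul_left (c := 2)
  have hae : ∀ᵐ s ∂volume, s ∈ Set.uIoc c d →
      (silhouette (shape l) (2 * s) : ℝ) + 1 = silhouette (shape (.node a l r)) s := by
    filter_upwards [Measure.ae_ne volume (1 / 2 : ℝ)] with s hs hsm
    rw [Set.uIoc_of_le hcd] at hsm
    rw [silhouette_node_left a l r (hc.trans hsm.1.le) (lt_of_le_of_ne (hsm.2.trans hd) hs)]
    push_cast; rfl
  have hi := hl'.add (intervalIntegrable_const (c := (1 : ℝ)))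
  refine ⟨hi.congr_ae ((ae_restrict_iff' measurableSet_uIoc).2 hae), ?_⟩
  rw [← intervalIntegral.integral_congr_ae hae,
    intervalIntegral.integral_add hl' intervalIntegrable_const,
    intervalIntegral.integral_comp_mul_left (fun s => (silhouette (shape l) s : ℝ)) two_ne_zero]
  simp
  ring

theorem intervalIntegral_silhouette_node_right (a : ℝ) (l r : BinaryTree ℝ) {c d : ℝ}
    (hc : 1 / 2 ≤ c) (hcd : c ≤ d) (hd : d ≤ 1)
    (hr : IntervalIntegrable (fun s => (silhouette (shape r) s : ℝ)) volume
      (2 * c - 1) (2 * d - 1)) :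
    IntervalIntegrable (fun s => (silhouette (shape (.node a l r)) s : ℝ)) volume c d ∧
    ∫ s in c..d, (silhouette (shape (.node a l r)) s : ℝ) =
      (d - c) + (∫ s in (2 * c - 1)..(2 * d - 1), (silhouette (shape r) s : ℝ)) / 2 := by
  have hr' : IntervalIntegrable (fun s => (silhouette (shape r) (2 * s - 1) : ℝ)) volume c d := by
    have := (hr.comp_sub_right 1).comp_mul_left (c := 2)
    simpa using this
  have hae : ∀ᵐ s ∂volume, s ∈ Set.uIoc c d →
      (silhouette (shape r) (2 * s - 1) : ℝ) + 1 = silhouette (shape (.node a l r)) s := by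
    filter_upwards [Measure.ae_ne volume (1 : ℝ)] with s hs hsm
    rw [Set.uIoc_of_le hcd] at hsm
    rw [silhouette_node_right a l r (hc.trans hsm.1.le) (lt_of_le_of_ne (hsm.2.trans hd) hs)]
    push_cast; rfl
  have hi := hr'.add (intervalIntegrable_const (c := (1 : ℝ)))
  refine ⟨hi.congr_ae ((ae_restrict_iff' measurableSet_uIoc).2 hae), ?_⟩
  rw [← intervalIntegral.integral_congr_ae hae,
    intervalIntegral.integral_add hr' intervalIntegrable_const,
    intervalIntegral.integral_comp_mul_sub (fun s => (silhouette (shape r) s : ℝ)) two_ne_zero]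
  simp
  ring

theorem intervalIntegrable_silhouette (t : BinaryTree ℝ) :
    IntervalIntegrable (fun s => (silhouette (shape t) s : ℝ)) volume 0 1 := by
  induction t with
  | nil => simp [silhouette_nil]
  | node a l r hl hr =>
    refine (intervalIntegral_silhouette_node_left a l r le_rfl (by norm_num) le_rfl ?_).1.trans
      (intervalIntegral_silhouette_node_right a l r le_rfl (by norm_num) le_rfl ?_).1
    · simpa using hl
    · norm_num
      exact hr

theorem intervalIntegrable_silhouette_of_mem (t : BinaryTree ℝ) {c d : ℝ}
    (hc : 0 ≤ c) (hcd : c ≤ d) (hd : d ≤ 1) :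
    IntervalIntegrable (fun s => (silhouette (shape t) s : ℝ)) volume c d := by
  refine (intervalIntegrable_silhouette t).mono_set ?_
  rw [Set.uIcc_of_le hcd, Set.uIcc_of_le zero_le_one]
  exact Set.Icc_subset_Icc hc hd

theorem integral_silhouette (t : BinaryTree ℝ) :
    ∫ s in (0 : ℝ)..1, (silhouette (shape t) s : ℝ) = extPath t := by
  induction t with
  | nil => simp [silhouette_nil, extPath]
  | node a l r hl hr =>
    have h1 := intervalIntegral_silhouette_node_left a l r le_rfl (d := 1 / 2) (by norm_num) le_rfl
      (by simpa using intervalIntegrable_silhouette l)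
    have h2 := intervalIntegral_silhouette_node_right a l r (c := 1 / 2) le_rfl (by norm_num) le_rfl
      (by norm_num; exact intervalIntegrable_silhouette r)
    rw [← intervalIntegral.integral_add_adjacent_intervals h1.1 h2.1, h1.2, h2.2]
    norm_num [hl, hr, extPath]
    ring

/-! ### Dyadic indices -/

/-- The index of the word `0 u` if `j` is the index of `u`. -/
def lowIdx {k : ℕ} (j : Fin (2 ^ k)) : Fin (2 ^ (k + 1)) :=
  ⟨j, by have := j.2; rw [pow_succ]; omega⟩

/-- The index of the word `1 u` if `j` is the index of `u`. -/
def highIdx {k : ℕ} (j : Fin (2 ^ k)) : Fin (2 ^ (k + 1)) :=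
  ⟨2 ^ k + j, by have := j.2; rw [pow_succ]; omega⟩

theorem lowIdx_or_highIdx {k : ℕ} (i : Fin (2 ^ (k + 1))) :
    (∃ j, i = lowIdx j) ∨ ∃ j, i = highIdx j := by
  have hi := i.2.trans_eq (pow_succ 2 k)
  rcases lt_or_ge (i : ℕ) (2 ^ k) with h | h
  · exact Or.inl ⟨⟨i, h⟩, rfl⟩
  · refine Or.inr ⟨⟨i - 2 ^ k, by omega⟩, Fin.ext ?_⟩
    simp only [highIdx]
    omega

@[to_additive]
theorem prod_dyadic_succ {M : Type*} [CommMonoid M] {k : ℕ} (f : Fin (2 ^ (k + 1)) → M) :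
    ∏ i, f i = (∏ j : Fin (2 ^ k), f (lowIdx j)) * ∏ j : Fin (2 ^ k), f (highIdx j) := by
  have h : 2 ^ (k + 1) = 2 ^ k + 2 ^ k := by rw [pow_succ]; omega
  rw [← Equiv.prod_comp (finCongr h.symm) f, Fin.prod_univ_add]
  rfl

theorem dyadicLetter_lowIdx_zero {k : ℕ} (j : Fin (2 ^ k)) :
    dyadicLetter (k + 1) (lowIdx j) 0 = false := by
  simp [dyadicLetter, lowIdx, Nat.div_eq_of_lt j.2]

theorem dyadicLetter_highIdx_zero {k : ℕ} (j : Fin (2 ^ k)) :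
    dyadicLetter (k + 1) (highIdx j) 0 = true := by
  simp [dyadicLetter, highIdx, Nat.div_eq_of_lt j.2]

theorem dyadicLetter_lowIdx_succ {k : ℕ} (j : Fin (2 ^ k)) (l : ℕ) :
    dyadicLetter (k + 1) (lowIdx j) (l + 1) = dyadicLetter k j l := by
  simp [dyadicLetter, lowIdx, Nat.add_sub_add_right]

theorem dyadicLetter_highIdx_succ {k : ℕ} (j : Fin (2 ^ k)) {l : ℕ} (hl : l < k) :
    dyadicLetter (k + 1) (highIdx j) (l + 1) = dyadicLetter k j l := by
  have h : 2 ^ k = 2 ^ (k - (l + 1)) * (2 * 2 ^ l) := by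
    rw [← pow_succ', ← pow_add]
    congr 1
    omega
  simp only [dyadicLetter, highIdx, Nat.add_sub_add_right]
  have : (2 ^ k + (j : ℕ)) / 2 ^ (k - (l + 1)) % 2 = (j : ℕ) / 2 ^ (k - (l + 1)) % 2 := by
    generalize (j : ℕ) = i
    rw [h, Nat.mul_add_div (by positivity), Nat.mul_add_mod]
  simp only [this]

theorem dyadicAncestor_lowIdx_succ {k : ℕ} (j : Fin (2 ^ k)) (l : ℕ) :
    dyadicAncestor (k + 1) (lowIdx j) (l + 1) = false :: dyadicAncestor k j l := by
  simp [dyadicAncestor, List.ofFn_succ, dyadicLetter_lowIdx_zero, dyadicLetter_lowIdx_succ]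

theorem dyadicAncestor_highIdx_succ {k : ℕ} (j : Fin (2 ^ k)) {l : ℕ} (hl : l ≤ k) :
    dyadicAncestor (k + 1) (highIdx j) (l + 1) = true :: dyadicAncestor k j l := by
  simp only [dyadicAncestor, List.ofFn_succ, Fin.val_zero, dyadicLetter_highIdx_zero, Fin.val_succ]
  congr 2
  ext i
  rw [dyadicLetter_highIdx_succ j (i.2.trans_le hl)]

theorem pathLogSum_lowIdx {k : ℕ} (ξ : List Bool → ℝ) (j : Fin (2 ^ k)) :
    pathLogSum (k + 1) ξ (lowIdx j) =
      Real.log (1 - ξ []) + pathLogSum k (fun u => ξ (false :: u)) j := by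
  simp only [pathLogSum, Fin.sum_univ_succ, Fin.val_zero, Fin.val_succ, dyadicLetter_lowIdx_zero,
    dyadicLetter_lowIdx_succ, dyadicAncestor_lowIdx_succ]
  simp [dyadicAncestor]

theorem pathLogSum_highIdx {k : ℕ} (ξ : List Bool → ℝ) (j : Fin (2 ^ k)) :
    pathLogSum (k + 1) ξ (highIdx j) =
      Real.log (ξ []) + pathLogSum k (fun u => ξ (true :: u)) j := by
  simp only [pathLogSum, Fin.sum_univ_succ, Fin.val_zero, Fin.val_succ, dyadicLetter_highIdx_zero,
    dyadicLetter_highIdx_succ _ (Fin.is_lt _), dyadicAncestor_highIdx_succ _ (Fin.is_lt _).le]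
  simp [dyadicAncestor]

/-- The mean of the silhouette over the dyadic interval of depth `k` with index `j`. -/
noncomputable def dyadicPath {α : Type*} (k : ℕ) (j : Fin (2 ^ k)) (t : BinaryTree α) : ℝ :=
  localPath (dyadicAncestor k j k) t

theorem dyadicPath_map {α β : Type*} (f : α → β) (k : ℕ) (j : Fin (2 ^ k)) (t : BinaryTree α) :
    dyadicPath k j (t.map f) = dyadicPath k j t :=
  localPath_map f _ t

theorem dyadicPath_zero {α : Type*} (j : Fin (2 ^ 0)) (t : BinaryTree α) :
    dyadicPath 0 j t = extPath t := by
  simp [dyadicPath, dyadicAncestor, localPath]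

theorem dyadicPath_nil {α : Type*} (k : ℕ) (j : Fin (2 ^ k)) :
    dyadicPath k j (.nil : BinaryTree α) = 0 := by
  rw [dyadicPath]
  cases dyadicAncestor k j k <;> rfl

theorem dyadicPath_lowIdx {α : Type*} {k : ℕ} (j : Fin (2 ^ k)) (a : α) (l r : BinaryTree α) :
    dyadicPath (k + 1) (lowIdx j) (.node a l r) = 1 + dyadicPath k j l := by
  simp [dyadicPath, dyadicAncestor_lowIdx_succ, localPath]

theorem dyadicPath_highIdx {α : Type*} {k : ℕ} (j : Fin (2 ^ k)) (a : α) (l r : BinaryTree α) :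
    dyadicPath (k + 1) (highIdx j) (.node a l r) = 1 + dyadicPath k j r := by
  simp [dyadicPath, dyadicAncestor_highIdx_succ j le_rfl, localPath]

theorem sum_dyadicPath {α : Type*} (k : ℕ) (t : BinaryTree α) :
    ∑ j, dyadicPath k j t = 2 ^ k * extPath t := by
  induction k generalizing t with
  | zero => simp [dyadicPath_zero]
  | succ k ih =>
    cases t with
    | nil => simp [dyadicPath_nil, extPath]
    | node a l r =>
      rw [sum_dyadic_succ]
      simp only [dyadicPath_lowIdx, dyadicPath_highIdx, Finset.sum_add_distrib, ih, extPath]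
      simp
      ring

theorem integral_silhouette_dyadic (k : ℕ) (j : Fin (2 ^ k)) (t : BinaryTree ℝ) :
    ∫ s in (((j : ℕ) : ℝ) / 2 ^ k)..(((j : ℕ) + 1 : ℝ) / 2 ^ k), (silhouette (shape t) s : ℝ) =
      dyadicPath k j t / 2 ^ k := by
  induction k generalizing t with
  | zero =>
    simp [dyadicPath_zero, integral_silhouette]
  | succ k ih =>
    cases t with
    | nil => simp [silhouette_nil, dyadicPath_nil]
    | node a l r =>
      have key : ∀ i : Fin (2 ^ k), ((i : ℕ) : ℝ) + 1 ≤ 2 ^ k := fun i => by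
        exact_mod_cast i.2
      have h2 : (0 : ℝ) < 2 ^ k := by positivity
      have hle : ∀ x : ℝ, x / 2 ^ k ≤ (x + 1) / 2 ^ k := fun x => by gcongr; linarith
      have hnn : ∀ i : Fin (2 ^ k), 0 ≤ ((i : ℕ) : ℝ) / 2 ^ k := fun i => by positivity
      have hone : ∀ i : Fin (2 ^ k), (((i : ℕ) : ℝ) + 1) / 2 ^ k ≤ 1 := fun i => by
        rw [div_le_one h2]; exact key i
      rcases lowIdx_or_highIdx j with ⟨i, rfl⟩ | ⟨i, rfl⟩
      · have e1 : 2 * (((lowIdx i : ℕ) : ℝ) / 2 ^ (k + 1)) = ((i : ℕ) : ℝ) / 2 ^ k := by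
          simp only [lowIdx, pow_succ]; field_simp
        have e2 : 2 * ((((lowIdx i : ℕ) : ℝ) + 1) / 2 ^ (k + 1)) = (((i : ℕ) : ℝ) + 1) / 2 ^ k := by
          simp only [lowIdx, pow_succ]; field_simp
        have := hle (i : ℕ)
        have := hnn i
        have := hone i
        rw [(intervalIntegral_silhouette_node_left a l r (by linarith) (by linarith) (by linarith)
          ?_).2, e1, e2, ih, dyadicPath_lowIdx]
        · simp only [pow_succ]; field_simp; ring
        · rw [e1, e2]
          exact intervalIntegrable_silhouette_of_mem l (hnn i) (hle _) (hone i)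
      · have e1 : 2 * (((highIdx i : ℕ) : ℝ) / 2 ^ (k + 1)) - 1 = ((i : ℕ) : ℝ) / 2 ^ k := by
          simp only [highIdx, pow_succ]; push_cast; field_simp; ring
        have e2 : 2 * ((((highIdx i : ℕ) : ℝ) + 1) / 2 ^ (k + 1)) - 1 =
            (((i : ℕ) : ℝ) + 1) / 2 ^ k := by
          simp only [highIdx, pow_succ]; push_cast; field_simp; ring
        have := hle (i : ℕ)
        have := hnn i
        have := hone i
        rw [(intervalIntegral_silhouette_node_right a l r (by linarith) (by linarith) (by linarith)
          ?_).2, e1, e2, ih, dyadicPath_highIdx]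
        · simp only [pow_succ]; field_simp; ring
        · rw [e1, e2]
          exact intervalIntegrable_silhouette_of_mem r (hnn i) (hle _) (hone i)

theorem dyadicIncr_normSilhouette (k : ℕ) (j : Fin (2 ^ k)) (t : BinaryTree ℝ) :
    dyadicIncr k (normSilhouette (shape t)) j = (dyadicPath k j t - extPath t) / 2 ^ k := by
  have h2 : (0 : ℝ) < 2 ^ k := by positivity
  have h1 : ((j : ℕ) : ℝ) + 1 ≤ 2 ^ k := by exact_mod_cast j.2
  have hj : 0 ≤ ((j : ℕ) : ℝ) / 2 ^ k := by positivity
  have hle : ((j : ℕ) : ℝ) / 2 ^ k ≤ (((j : ℕ) : ℝ) + 1) / 2 ^ k := by gcongr; linarith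
  have hone : (((j : ℕ) : ℝ) + 1) / 2 ^ k ≤ 1 := by rw [div_le_one h2]; exact h1
  have hadd := intervalIntegral.integral_add_adjacent_intervals
    (intervalIntegrable_silhouette_of_mem t le_rfl hj (hle.trans hone))
    (intervalIntegrable_silhouette_of_mem t hj hle hone)
  rw [integral_silhouette_dyadic] at hadd
  simp only [dyadicIncr, normSilhouette, intSilhouette, integral_silhouette, ← hadd]
  field_simp
  ring

theorem centeredPathLength_shape (t : BinaryTree ℝ) :
    centeredPathLength (shape t) = extPath t - ((harmonic t.numNodes : ℚ) : ℝ) := by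
  rw [centeredPathLength, pathLength, integral_silhouette]
  simp [shape, card_nodeSet]

/-! ### The shape of a binary search tree in terms of relative ranks -/

/-- Attach a new node at the external node with index `j`, in the order from left to right. -/
def insAt : ℕ → BinaryTree Unit → BinaryTree Unit
  | _, .nil => .node () .nil .nil
  | j, .node _ l r =>
    if j ≤ l.numNodes then .node () (insAt j l) r else .node () l (insAt (j - l.numNodes - 1) r)

theorem numNodes_insAt (j : ℕ) (t : BinaryTree Unit) :
    (insAt j t).numNodes = t.numNodes + 1 := by
  induction t generalizing j with
  | nil => rfl
  | node a l r hl hr =>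
    rw [insAt]
    split_ifs
    · simp only [BinaryTree.numNodes, hl]; omega
    · simp only [BinaryTree.numNodes, hr]; omega

/-- The tree obtained from the empty tree by attaching nodes at the external nodes with the given
indices. -/
def insSeq (r : ℕ → ℕ) : ℕ → BinaryTree Unit
  | 0 => .nil
  | n + 1 => insAt (r n) (insSeq r n)

theorem numNodes_insSeq (r : ℕ → ℕ) (n : ℕ) : (insSeq r n).numNodes = n := by
  induction n with
  | zero => rfl
  | succ n ih => rw [insSeq, numNodes_insAt, ih]

theorem insSeq_congr {r r' : ℕ → ℕ} {n : ℕ} (h : ∀ i < n, r i = r' i) :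
    insSeq r n = insSeq r' n := by
  induction n with
  | zero => rfl
  | succ n ih => rw [insSeq, insSeq, ih fun i hi => h i (by omega), h n (by omega)]

/-- The number of labels that are at most `y`. -/
noncomputable def countLe : BinaryTree ℝ → ℝ → ℕ
  | .nil, _ => 0
  | .node a l r, y => countLe l y + countLe r y + if a ≤ y then 1 else 0

/-- The search tree property: labels in a left subtree are smaller than the label of the node, and
labels in a right subtree are not. -/
def IsSearchTree : BinaryTree ℝ → Prop
  | .nil => True
  | .node a l r => IsSearchTree l ∧ IsSearchTree r ∧
      (∀ y, a ≤ y → countLe l y = l.numNodes) ∧ ∀ y, y < a → countLe r y = 0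

theorem numNodes_bstInsert (x : ℝ) (t : BinaryTree ℝ) :
    (bstInsert x t).numNodes = t.numNodes + 1 := by
  induction t with
  | nil => rfl
  | node a l r hl hr =>
    rw [bstInsert]
    split_ifs
    · simp only [BinaryTree.numNodes, hl]; omega
    · simp only [BinaryTree.numNodes, hr]; omega

theorem countLe_bstInsert (x y : ℝ) (t : BinaryTree ℝ) :
    countLe (bstInsert x t) y = countLe t y + if x ≤ y then 1 else 0 := by
  induction t with
  | nil => simp [bstInsert, countLe]
  | node a l r hl hr =>
    rw [bstInsert]
    split_ifs <;> simp_all [countLe] <;> omega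

theorem countLe_le_numNodes (t : BinaryTree ℝ) (y : ℝ) : countLe t y ≤ t.numNodes := by
  induction t with
  | nil => simp [countLe]
  | node a l r hl hr =>
    simp only [countLe, BinaryTree.numNodes]
    split_ifs <;> omega

theorem IsSearchTree.bstInsert {t : BinaryTree ℝ} (ht : IsSearchTree t) (x : ℝ) :
    IsSearchTree (bstInsert x t) := by
  induction t with
  | nil => simp [Silhouette.bstInsert, IsSearchTree, countLe]
  | node a l r hl hr =>
    obtain ⟨h1, h2, h3, h4⟩ := ht
    rw [Silhouette.bstInsert]
    split_ifs with hx
    · refine ⟨hl h1, h2, fun y hy => ?_, h4⟩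
      rw [countLe_bstInsert, numNodes_bstInsert, h3 y hy, if_pos (hx.le.trans hy)]
    · refine ⟨h1, hr h2, h3, fun y hy => ?_⟩
      rw [countLe_bstInsert, h4 y hy, if_neg (by linarith)]

theorem map_bstInsert {t : BinaryTree ℝ} (ht : IsSearchTree t) (x : ℝ) :
    (bstInsert x t).map (fun _ => ()) = insAt (countLe t x) (t.map fun _ => ()) := by
  induction t with
  | nil => rfl
  | node a l r hl hr =>
    obtain ⟨h1, h2, h3, h4⟩ := ht
    rw [bstInsert, BinaryTree.map, insAt, numNodes_map, countLe]
    by_cases hx : x < a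
    · have := countLe_le_numNodes l x
      rw [if_pos hx, h4 x hx, if_neg (c := a ≤ x) (by linarith), if_pos (by simpa using this)]
      simp [BinaryTree.map, hl h1]
    · rw [if_neg hx, h3 x (by linarith), if_pos (c := a ≤ x) (by linarith), if_neg (by omega)]
      have : l.numNodes + countLe r x + 1 - l.numNodes - 1 = countLe r x := by omega
      rw [this, BinaryTree.map, hr h2]

/-- The relative rank of the term with index `n` among the earlier terms. -/
noncomputable def relRank (x : ℕ → ℝ) (n : ℕ) : ℕ :=
  ((Finset.range n).filter fun i => x i ≤ x n).card

theorem relRank_le (x : ℕ → ℝ) (n : ℕ) : relRank x n ≤ n :=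
  (Finset.card_filter_le _ _).trans_eq (Finset.card_range n)

theorem isSearchTree_bstLabeled (x : ℕ → ℝ) (n : ℕ) : IsSearchTree (bstLabeled x n) := by
  induction n with
  | zero => trivial
  | succ n ih => exact ih.bstInsert _

theorem countLe_bstLabeled (x : ℕ → ℝ) (n : ℕ) (y : ℝ) :
    countLe (bstLabeled x n) y = ((Finset.range n).filter fun i => x i ≤ y).card := by
  induction n with
  | zero => rfl
  | succ n ih =>
    rw [bstLabeled, countLe_bstInsert, ih, Finset.range_add_one, Finset.filter_insert]
    split_ifs <;> simp

theorem map_bstLabeled (x : ℕ → ℝ) (n : ℕ) :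
    (bstLabeled x n).map (fun _ => ()) = insSeq (relRank x) n := by
  induction n with
  | zero => rfl
  | succ n ih =>
    rw [bstLabeled, map_bstInsert (isSearchTree_bstLabeled x n), ih, countLe_bstLabeled]
    rfl

theorem numNodes_bstLabeled (x : ℕ → ℝ) (n : ℕ) : (bstLabeled x n).numNodes = n := by
  rw [← numNodes_map (fun _ => ()), map_bstLabeled, numNodes_insSeq]

/-! ### The relative ranks of independent uniform random variables -/

instance : IsProbabilityMeasure unif := ⟨by simp [unif]⟩

instance : NullSingletonClass unif := by unfold unif; infer_instance

/-- The law of a sequence of independent uniform random variables. -/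
noncomputable def unifSeq : Measure (ℕ → ℝ) := Measure.infinitePi fun _ => unif

instance : IsProbabilityMeasure unifSeq := by unfold unifSeq; infer_instance

theorem measurePreserving_swap (m n : ℕ) :
    MeasurePreserving (fun x : ℕ → ℝ => fun i => x (Equiv.swap m n i)) unifSeq unifSeq :=
  ⟨by fun_prop, Measure.map_infinitePi_infinitePi_of_inj (P := fun _ : ℕ => unif)
    (Equiv.swap m n).injective⟩

theorem ae_injective_unifSeq : ∀ᵐ x ∂unifSeq, Function.Injective x := by
  have h : ∀ i j : ℕ, i ≠ j → ∀ᵐ x ∂unifSeq, x i ≠ x j := by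
    intro i j hij
    have hd : MeasurableSet {p : ℝ × ℝ | p.1 = p.2} :=
      measurableSet_eq_fun (by fun_prop) (by fun_prop)
    have h0 : (unif.prod unif) {p : ℝ × ℝ | p.1 = p.2} = 0 := by
      rw [Measure.measure_prod_null hd]
      refine ae_of_all _ fun a => ?_
      have : Prod.mk a ⁻¹' {p : ℝ × ℝ | p.1 = p.2} = {a} := by ext b; simp [eq_comm]
      simp [this]
    rw [← Measure.infinitePi_map_eval_prod (P := fun _ : ℕ => unif) hij,
      Measure.map_apply (by fun_prop) hd] at h0
    rw [ae_iff]
    simpa [unifSeq] using h0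
  have : ∀ᵐ x ∂unifSeq, ∀ i j : ℕ, i ≠ j → x i ≠ x j := by
    simp only [ae_all_iff]
    exact h
  filter_upwards [this] with x hx i j hij
  by_contra hne
  exact hx i j hne hij

@[fun_prop]
theorem measurable_relRank : Measurable relRank := by
  refine measurable_pi_iff.2 fun n => ?_
  have : (fun x : ℕ → ℝ => relRank x n) =
      fun x => ∑ i ∈ Finset.range n, if x i ≤ x n then 1 else 0 := by
    ext x; rw [relRank, Finset.card_filter]
  rw [this]
  refine Finset.measurable_fun_sum _ fun i _ => ?_
  exact Measurable.ite (measurableSet_le (by fun_prop) (by fun_prop)) measurable_const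
    measurable_const

section Rank

variable {𝕜 : Type*} [RCLike 𝕜] {n : ℕ}

theorem _root_.DependsOn.measurable_relRank {g : (ℕ → ℕ) → 𝕜} (hg : DependsOn g (Set.Iio n)) :
    Measurable fun x => g (relRank x) := by
  obtain ⟨g', rfl⟩ := dependsOn_iff_exists_comp.1 hg
  refine (measurable_of_countable g').comp ?_
  exact measurable_pi_iff.2 fun i =>
    (measurable_pi_apply (i : ℕ)).comp Silhouette.measurable_relRank

theorem _root_.DependsOn.exists_bound_relRank {g : (ℕ → ℕ) → 𝕜} (hg : DependsOn g (Set.Iio n)) :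
    ∃ C, ∀ x, ‖g (relRank x)‖ ≤ C := by
  obtain ⟨g', rfl⟩ := dependsOn_iff_exists_comp.1 hg
  have hfin : (Set.univ.pi fun i : Set.Iio n => Set.Iic (i : ℕ)).Finite :=
    Set.Finite.pi fun i => Set.finite_Iic _
  obtain ⟨C, hC⟩ := (hfin.image fun r => ‖g' r‖).bddAbove
  exact ⟨C, fun x => hC ⟨_, fun i _ => relRank_le x i, rfl⟩⟩

theorem _root_.DependsOn.integrable_relRank {g : (ℕ → ℕ) → 𝕜} (hg : DependsOn g (Set.Iio n)) :
    Integrable (fun x => g (relRank x)) unifSeq := by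
  obtain ⟨C, hC⟩ := hg.exists_bound_relRank
  exact Integrable.of_bound hg.measurable_relRank.aestronglyMeasurable C (ae_of_all _ hC)

/-- The value with index `b` follows that with index `a` in the order of the first `n` values. -/
def IsNextValue (n a b : ℕ) (x : ℕ → ℝ) : Prop :=
  x a < x b ∧ ∀ i < n, ¬ (x a < x i ∧ x i < x b)

theorem measurableSet_isNextValue (n a b : ℕ) : MeasurableSet {x | IsNextValue n a b x} := by
  have : {x | IsNextValue n a b x} = {x | x a < x b} ∩
      ⋂ i ∈ Finset.range n, ({x | x a < x i} ∩ {x | x i < x b})ᶜ := by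
    ext x; simp [IsNextValue]
  rw [this]
  refine MeasurableSet.inter (measurableSet_lt (by fun_prop) (by fun_prop)) ?_
  refine Finset.measurableSet_biInter _ fun i _ => MeasurableSet.compl ?_
  exact (measurableSet_lt (by fun_prop) (by fun_prop)).inter
    (measurableSet_lt (by fun_prop) (by fun_prop))

theorem isNextValue_swap {m : ℕ} (hm : m < n) (x : ℕ → ℝ) :
    IsNextValue n n m (fun i => x (Equiv.swap m n i)) ↔ IsNextValue n m n x := by
  simp only [IsNextValue, Equiv.swap_apply_left, Equiv.swap_apply_right]
  refine and_congr_right fun h => forall₂_congr fun i hi => ?_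
  rcases eq_or_ne i m with rfl | him
  · simp
  · rw [Equiv.swap_apply_of_ne_of_ne him hi.ne]

theorem relRank_swap {m i : ℕ} (hm : m < n) (hi : i < n) {x : ℕ → ℝ} (hx : Function.Injective x)
    (h : IsNextValue n m n x) : relRank (fun i => x (Equiv.swap m n i)) i = relRank x i := by
  have key : ∀ l < n, ∀ i < n, x (Equiv.swap m n l) ≤ x (Equiv.swap m n i) ↔ x l ≤ x i := by
    intro l hl i hi
    rcases eq_or_ne l m with hlm | hlm <;> rcases eq_or_ne i m with him | him
    · simp [hlm, him]
    · subst hlm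
      rw [Equiv.swap_apply_left, Equiv.swap_apply_of_ne_of_ne him hi.ne]
      refine ⟨fun h' => h.1.le.trans h', fun h' => ?_⟩
      by_contra! hlt
      exact h.2 i hi ⟨lt_of_le_of_ne h' (hx.ne him.symm), hlt⟩
    · subst him
      rw [Equiv.swap_apply_left, Equiv.swap_apply_of_ne_of_ne hlm hl.ne]
      refine ⟨fun h' => ?_, fun h' => h'.trans h.1.le⟩
      by_contra! hlt
      exact h.2 l hl ⟨hlt, lt_of_le_of_ne h' (hx.ne hl.ne)⟩
    · rw [Equiv.swap_apply_of_ne_of_ne him hi.ne, Equiv.swap_apply_of_ne_of_ne hlm hl.ne]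
  unfold relRank
  congr 1
  refine Finset.filter_congr fun l hl => key l ?_ i hi
  exact (Finset.mem_range.1 hl).trans hi

theorem relRank_swap_self {m : ℕ} (hm : m < n) {x : ℕ → ℝ} (hx : Function.Injective x)
    (h : IsNextValue n m n x) : relRank x n = relRank (fun i => x (Equiv.swap m n i)) n + 1 := by
  unfold relRank
  rw [← Finset.card_insert_of_notMem (a := m)]
  · congr 1
    ext l
    simp only [Finset.mem_filter, Finset.mem_insert, Finset.mem_range, Equiv.swap_apply_right]
    rcases eq_or_ne l m with rfl | hlm
    · simp [hm, h.1.le]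
    · simp only [hlm, false_or]
      refine and_congr_right fun hl => ?_
      rw [Equiv.swap_apply_of_ne_of_ne hlm hl.ne]
      refine ⟨fun h' => ?_, fun h' => h'.trans h.1.le⟩
      by_contra! hlt
      exact h.2 l hl ⟨hlt, lt_of_le_of_ne h' (hx.ne hl.ne)⟩
  · simp [h.1]

theorem exists_isNextValue_above {x : ℕ → ℝ} (h : relRank x n < n) :
    ∃ m < n, IsNextValue n n m x := by
  have hne : ((Finset.range n).filter fun i => x n < x i).Nonempty := by
    by_contra! hemp
    rw [Finset.filter_eq_empty_iff] at hemp
    have : relRank x n = n := by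
      rw [relRank, Finset.filter_true_of_mem fun i hi => not_lt.1 (hemp hi), Finset.card_range]
    omega
  obtain ⟨m, hm, hmin⟩ := Finset.exists_min_image _ x hne
  simp only [Finset.mem_filter, Finset.mem_range] at hm hmin
  exact ⟨m, hm.1, hm.2, fun i hi hi' => (hmin i ⟨hi, hi'.1⟩).not_gt hi'.2⟩

theorem exists_isNextValue_below {x : ℕ → ℝ} (hx : Function.Injective x) (h : 0 < relRank x n) :
    ∃ m < n, IsNextValue n m n x := by
  rw [relRank, Finset.card_pos] at h
  obtain ⟨m, hm, hmax⟩ := Finset.exists_max_image _ x h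
  simp only [Finset.mem_filter, Finset.mem_range] at hm hmax
  refine ⟨m, hm.1, lt_of_le_of_ne hm.2 (hx.ne hm.1.ne), fun i hi hi' => ?_⟩
  exact (hmax i ⟨hi, hi'.2.le⟩).not_gt hi'.1

theorem isNextValue_above_unique {x : ℕ → ℝ} (hx : Function.Injective x) {m m' : ℕ} (hm : m < n)
    (hm' : m' < n) (h : IsNextValue n n m x) (h' : IsNextValue n n m' x) : m = m' := by
  by_contra hne
  rcases (hx.ne hne).lt_or_gt with hlt | hlt
  · exact h'.2 m hm ⟨h.1, hlt⟩
  · exact h.2 m' hm' ⟨h'.1, hlt⟩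

theorem isNextValue_below_unique {x : ℕ → ℝ} (hx : Function.Injective x) {m m' : ℕ} (hm : m < n)
    (hm' : m' < n) (h : IsNextValue n m n x) (h' : IsNextValue n m' n x) : m = m' := by
  by_contra hne
  rcases (hx.ne hne).lt_or_gt with hlt | hlt
  · exact h.2 m' hm' ⟨hlt, h'.1⟩
  · exact h'.2 m hm ⟨hlt, h.1⟩

open scoped Classical in
theorem integral_relRank_eq_succ {g : (ℕ → ℕ) → 𝕜} (hg : DependsOn g (Set.Iio n)) {j : ℕ}
    (hj : j < n) :
    ∫ x, (if relRank x n = j then g (relRank x) else 0) ∂unifSeq =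
      ∫ x, (if relRank x n = j + 1 then g (relRank x) else 0) ∂unifSeq := by
  have hgm := hg.measurable_relRank
  have hint : ∀ (a b i : ℕ), Integrable (fun x => if IsNextValue n a b x ∧ relRank x n = i then
      g (relRank x) else 0) unifSeq := by
    intro a b i
    have hs : MeasurableSet {x : ℕ → ℝ | IsNextValue n a b x ∧ relRank x n = i} :=
      (measurableSet_isNextValue n a b).inter
        (measurableSet_eq_fun (f := fun x => relRank x n) (by fun_prop) measurable_const)
    obtain ⟨C, hC⟩ := hg.exists_bound_relRank
    refine Integrable.of_bound (C := C)
      (Measurable.ite hs hgm measurable_const).aestronglyMeasurable (ae_of_all _ fun x => ?_)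
    split_ifs
    · exact hC x
    · rw [norm_zero]; exact (norm_nonneg _).trans (hC x)
  have h1 : ∫ x, (if relRank x n = j then g (relRank x) else 0) ∂unifSeq =
      ∫ x, ∑ m ∈ Finset.range n, (if IsNextValue n n m x ∧ relRank x n = j then
        g (relRank x) else 0) ∂unifSeq := by
    refine integral_congr_ae ?_
    filter_upwards [ae_injective_unifSeq] with x hx
    by_cases hr : relRank x n = j
    · obtain ⟨m, hm, hmn⟩ := exists_isNextValue_above (hr.trans_lt hj)
      rw [Finset.sum_eq_single_of_mem m (Finset.mem_range.2 hm)]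
      · simp [hr, hmn]
      · intro m' hm' hne
        rw [if_neg]
        exact fun h => hne (isNextValue_above_unique hx (Finset.mem_range.1 hm') hm h.1 hmn)
    · simp [hr]
  have h2 : ∫ x, (if relRank x n = j + 1 then g (relRank x) else 0) ∂unifSeq =
      ∫ x, ∑ m ∈ Finset.range n, (if IsNextValue n m n x ∧ relRank x n = j + 1 then
        g (relRank x) else 0) ∂unifSeq := by
    refine integral_congr_ae ?_
    filter_upwards [ae_injective_unifSeq] with x hx
    by_cases hr : relRank x n = j + 1
    · obtain ⟨m, hm, hmn⟩ := exists_isNextValue_below hx (n := n) (by omega)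
      rw [Finset.sum_eq_single_of_mem m (Finset.mem_range.2 hm)]
      · simp [hr, hmn]
      · intro m' hm' hne
        rw [if_neg]
        exact fun h => hne (isNextValue_below_unique hx (Finset.mem_range.1 hm') hm h.1 hmn)
    · simp [hr]
  rw [h1, h2, integral_finsetSum _ fun m _ => hint n m j,
    integral_finsetSum _ fun m _ => hint m n (j + 1)]
  refine Finset.sum_congr rfl fun m hm => ?_
  rw [Finset.mem_range] at hm
  have hmp := measurePreserving_swap m n
  rw [← hmp.map_eq, integral_map hmp.measurable.aemeasurable
    (by rw [hmp.map_eq]; exact (hint n m j).aestronglyMeasurable)]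
  conv_rhs => rw [hmp.map_eq]
  refine integral_congr_ae ?_
  filter_upwards [ae_injective_unifSeq] with x hx
  rw [isNextValue_swap hm]
  by_cases hB : IsNextValue n m n x
  · rw [relRank_swap_self hm hx hB]
    have : g (relRank fun i => x (Equiv.swap m n i)) = g (relRank x) :=
      hg fun i hi => relRank_swap hm hi hx hB
    simp [this]
  · simp [hB]

/-- Given the earlier relative ranks, the next one is uniformly distributed. -/
theorem integral_relRank_succ (g : ℕ → (ℕ → ℕ) → 𝕜) (hg : ∀ j, DependsOn (g j) (Set.Iio n)) :
    ∫ x, g (relRank x n) (relRank x) ∂unifSeq =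
      (∑ j ∈ Finset.range (n + 1), ∫ x, g j (relRank x) ∂unifSeq) / (n + 1) := by
  have hint : ∀ (f : (ℕ → ℕ) → 𝕜), DependsOn f (Set.Iio n) → ∀ i : ℕ,
      Integrable (fun x => if relRank x n = i then f (relRank x) else 0) unifSeq := by
    intro f hf i
    have hs : MeasurableSet {x : ℕ → ℝ | relRank x n = i} :=
      measurableSet_eq_fun (f := fun x => relRank x n) (by fun_prop) measurable_const
    obtain ⟨C, hC⟩ := hf.exists_bound_relRank
    refine Integrable.of_bound (C := C)
      (Measurable.ite hs hf.measurable_relRank measurable_const).aestronglyMeasurable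
      (ae_of_all _ fun x => ?_)
    split_ifs
    · exact hC x
    · rw [norm_zero]; exact (norm_nonneg _).trans (hC x)
  have hsum : ∀ (f : ℕ → (ℕ → ℕ) → 𝕜), (∀ j, DependsOn (f j) (Set.Iio n)) →
      ∫ x, f (relRank x n) (relRank x) ∂unifSeq = ∑ j ∈ Finset.range (n + 1),
        ∫ x, (if relRank x n = j then f j (relRank x) else 0) ∂unifSeq := by
    intro f hf
    rw [← integral_finsetSum _ fun j _ => hint (f j) (hf j) j]
    congr 1 with x
    rw [Finset.sum_ite_eq, if_pos (Finset.mem_range.2 (Nat.lt_succ_of_le (relRank_le x n)))]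
  have hconst : ∀ (f : (ℕ → ℕ) → 𝕜), DependsOn f (Set.Iio n) → ∀ j ≤ n,
      ∫ x, (if relRank x n = j then f (relRank x) else 0) ∂unifSeq =
        ∫ x, (if relRank x n = 0 then f (relRank x) else 0) ∂unifSeq := by
    intro f hf j hj
    induction j with
    | zero => rfl
    | succ j ih => rw [← integral_relRank_eq_succ hf (by omega), ih (by omega)]
  have hunif : ∀ (f : (ℕ → ℕ) → 𝕜), DependsOn f (Set.Iio n) → ∀ j ≤ n,
      ∫ x, (if relRank x n = j then f (relRank x) else 0) ∂unifSeq =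
        (∫ x, f (relRank x) ∂unifSeq) / (n + 1) := by
    intro f hf j hj
    have hn : (n + 1 : 𝕜) ≠ 0 := by exact_mod_cast Nat.succ_ne_zero n
    rw [hsum (fun _ => f) fun _ => hf, Finset.sum_congr rfl fun i hi => hconst f hf i
      (Nat.lt_succ_iff.1 (Finset.mem_range.1 hi)), hconst f hf j hj]
    simp
    field_simp
  rw [hsum g hg, Finset.sum_div]
  exact Finset.sum_congr rfl fun j hj =>
    hunif (g j) (hg j) j (Nat.lt_succ_iff.1 (Finset.mem_range.1 hj))

end Rank

/-! ### The law of the shape of a random binary search tree -/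

section TreeMean

variable {𝕜 : Type*} [RCLike 𝕜]

/-- The sum of the values of `f` over all trees obtained by attaching a new node. -/
def insSum (f : BinaryTree Unit → 𝕜) (t : BinaryTree Unit) : 𝕜 :=
  ∑ j ∈ Finset.range (t.numNodes + 1), f (insAt j t)

/-- The expectation of `f` for the tree with `n` nodes that arises from attaching nodes at uniformly
chosen external nodes. -/
noncomputable def treeMean : ℕ → (BinaryTree Unit → 𝕜) → 𝕜
  | 0, f => f .nil
  | n + 1, f => treeMean n (insSum f) / (n + 1)

theorem insSum_node (f : BinaryTree Unit → 𝕜) (a : Unit) (l r : BinaryTree Unit) :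
    insSum f (.node a l r) =
      insSum (fun l' => f (.node () l' r)) l + insSum (fun r' => f (.node () l r')) r := by
  have h : l.numNodes + r.numNodes + 1 + 1 = (l.numNodes + 1) + (r.numNodes + 1) := by omega
  rw [insSum, BinaryTree.numNodes, h, Finset.sum_range_add]
  congr 1
  · refine Finset.sum_congr rfl fun j hj => ?_
    rw [insAt, if_pos (Nat.lt_succ_iff.1 (Finset.mem_range.1 hj))]
  · refine Finset.sum_congr rfl fun j _ => ?_
    rw [insAt, if_neg (by omega)]
    congr 3
    omega

theorem insSum_add (f g : BinaryTree Unit → 𝕜) (t : BinaryTree Unit) :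
    insSum (fun t => f t + g t) t = insSum f t + insSum g t :=
  Finset.sum_add_distrib

theorem insSum_mul_const (f : BinaryTree Unit → 𝕜) (c : 𝕜) (t : BinaryTree Unit) :
    insSum (fun t => f t * c) t = insSum f t * c :=
  (Finset.sum_mul _ _ _).symm

theorem insSum_const_mul (f : BinaryTree Unit → 𝕜) (c : 𝕜) (t : BinaryTree Unit) :
    insSum (fun t => c * f t) t = c * insSum f t :=
  (Finset.mul_sum _ _ _).symm

theorem insSum_const (c : 𝕜) (t : BinaryTree Unit) :
    insSum (fun _ => c) t = (t.numNodes + 1) * c := by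
  simp [insSum]

theorem treeMean_add (n : ℕ) (f g : BinaryTree Unit → 𝕜) :
    treeMean n (fun t => f t + g t) = treeMean n f + treeMean n g := by
  induction n generalizing f g with
  | zero => rfl
  | succ n ih =>
    have : insSum (fun t => f t + g t) = fun t => insSum f t + insSum g t :=
      funext (insSum_add f g)
    rw [treeMean, this, ih, treeMean, treeMean, add_div]

theorem treeMean_const_mul (n : ℕ) (f : BinaryTree Unit → 𝕜) (c : 𝕜) :
    treeMean n (fun t => c * f t) = c * treeMean n f := by
  induction n generalizing f with
  | zero => rfl
  | succ n ih =>
    have : insSum (fun t => c * f t) = fun t => c * insSum f t := funext (insSum_const_mul f c)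
    rw [treeMean, this, ih, treeMean, mul_div_assoc]

theorem treeMean_congr {n : ℕ} {f g : BinaryTree Unit → 𝕜}
    (h : ∀ t : BinaryTree Unit, t.numNodes = n → f t = g t) : treeMean n f = treeMean n g := by
  induction n generalizing f g with
  | zero => exact h _ rfl
  | succ n ih =>
    rw [treeMean, treeMean, ih fun t ht => ?_]
    exact Finset.sum_congr rfl fun j _ => h _ (by rw [numNodes_insAt, ht])

theorem treeMean_const (n : ℕ) (c : 𝕜) : treeMean n (fun _ => c) = c := by
  induction n generalizing c with
  | zero => rfl
  | succ n ih =>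
    have hn : (n + 1 : 𝕜) ≠ 0 := by exact_mod_cast Nat.succ_ne_zero n
    rw [treeMean, treeMean_congr (g := fun _ => (n + 1) * c) fun t ht => by
      rw [insSum_const, ht], ih]
    field_simp

theorem treeMean_sum {ι : Type*} (s : Finset ι) (n : ℕ) (f : ι → BinaryTree Unit → 𝕜) :
    treeMean n (fun t => ∑ i ∈ s, f i t) = ∑ i ∈ s, treeMean n (f i) := by
  classical
  induction s using Finset.induction_on with
  | empty => simpa using treeMean_const n (0 : 𝕜)
  | insert i s hi ih => simp only [Finset.sum_insert hi, treeMean_add, ih]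

/-- Given its size, the left subtree of a random binary search tree is a random binary search tree,
and similarly for the right subtree; the two are conditionally independent, and the size of the left
subtree is uniformly distributed. -/
theorem treeMean_left_mul_right (f g : BinaryTree Unit → 𝕜) (n : ℕ) :
    (n + 1) * treeMean (n + 1) (fun t => f t.left * g t.right) =
      ∑ p ∈ Finset.HasAntidiagonal.antidiagonal n, treeMean p.1 f * treeMean p.2 g := by
  induction n generalizing f g with
  | zero => simp [treeMean, insSum, insAt]
  | succ n ih =>
    have hn : (n + 1 : 𝕜) ≠ 0 := by exact_mod_cast Nat.succ_ne_zero n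
    have hn2 : ((n + 1 : ℕ) + 1 : 𝕜) ≠ 0 := by exact_mod_cast Nat.succ_ne_zero (n + 1)
    have key : treeMean (n + 1) (insSum fun t => f t.left * g t.right) =
        treeMean (n + 1) (fun t => insSum f t.left * g t.right) +
          treeMean (n + 1) (fun t => f t.left * insSum g t.right) := by
      rw [← treeMean_add]
      refine treeMean_congr fun t ht => ?_
      cases t with
      | nil => simp at ht
      | node a l r =>
        rw [insSum_node]
        simp only [BinaryTree.left, BinaryTree.right, insSum_mul_const, insSum_const_mul]
    have hsucc : ∀ (h : BinaryTree Unit → 𝕜) (i : ℕ),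
        treeMean i (insSum h) = ((i + 1 : ℕ) : 𝕜) * treeMean (i + 1) h := by
      intro h i
      have hi : (i + 1 : 𝕜) ≠ 0 := by exact_mod_cast Nat.succ_ne_zero i
      rw [treeMean]
      push_cast
      field_simp
    have h1 := Finset.Nat.sum_antidiagonal_succ (n := n)
      (f := fun p => (p.1 : 𝕜) * (treeMean p.1 f * treeMean p.2 g))
    have h2 := Finset.Nat.sum_antidiagonal_succ' (n := n)
      (f := fun p => (p.2 : 𝕜) * (treeMean p.1 f * treeMean p.2 g))
    have h3 : ∑ p ∈ Finset.HasAntidiagonal.antidiagonal (n + 1),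
          (p.1 : 𝕜) * (treeMean p.1 f * treeMean p.2 g) +
        ∑ p ∈ Finset.HasAntidiagonal.antidiagonal (n + 1),
          (p.2 : 𝕜) * (treeMean p.1 f * treeMean p.2 g) =
        (n + 1) * ∑ p ∈ Finset.HasAntidiagonal.antidiagonal (n + 1),
          treeMean p.1 f * treeMean p.2 g := by
      rw [← Finset.sum_add_distrib, Finset.mul_sum]
      refine Finset.sum_congr rfl fun p hp => ?_
      have : (p.1 : 𝕜) + p.2 = n + 1 := by
        exact_mod_cast Finset.HasAntidiagonal.mem_antidiagonal.1 hp
      rw [← add_mul, this]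
    rw [treeMean, mul_div_cancel₀ _ hn2, key]
    apply mul_left_cancel₀ hn
    rw [mul_add, ih, ih, ← h3, h1, h2]
    simp only [hsucc]
    simp [mul_assoc, mul_left_comm]

theorem dependsOn_insSeq {β : Type*} (n : ℕ) (f : BinaryTree Unit → β) :
    DependsOn (fun r => f (insSeq r n)) (Set.Iio n) :=
  fun _ _ h => congrArg f (insSeq_congr h)

theorem integral_insSeq_relRank (n : ℕ) (f : BinaryTree Unit → 𝕜) :
    ∫ x, f (insSeq (relRank x) n) ∂unifSeq = treeMean n f := by
  induction n generalizing f with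
  | zero => simp [insSeq, treeMean]
  | succ n ih =>
    have := integral_relRank_succ (n := n) (fun j r => f (insAt j (insSeq r n)))
      fun j => dependsOn_insSeq n fun t => f (insAt j t)
    rw [show (fun x => f (insSeq (relRank x) (n + 1))) =
      fun x => f (insAt (relRank x n) (insSeq (relRank x) n)) from rfl, this, treeMean]
    congr 1
    rw [Finset.sum_congr rfl fun j _ => ih fun t => f (insAt j t), ← treeMean_sum]
    refine treeMean_congr fun t ht => ?_
    rw [insSum, ht]

end TreeMean

/-! ### Moments of the path length -/

/-- The sum of `4 ^ (-d)` over the external nodes, where `d` is the depth. -/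
noncomputable def extQuad : BinaryTree Unit → ℝ
  | .nil => 1
  | .node _ l r => (extQuad l + extQuad r) / 4

theorem extQuad_nonneg (t : BinaryTree Unit) : 0 ≤ extQuad t := by
  induction t with
  | nil => simp [extQuad]
  | node a l r hl hr => rw [extQuad]; positivity

theorem insSum_extPath (t : BinaryTree Unit) :
    insSum extPath t = (t.numNodes + 1) * extPath t + 1 := by
  induction t with
  | nil => simp [insSum, insAt, extPath]
  | node a l r hl hr =>
    have e1 : (fun l' : BinaryTree Unit => extPath (.node () l' r)) =
        fun l' => (1 / 2 : ℝ) * extPath l' + (1 + extPath r / 2) := by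
      ext; rw [extPath]; ring
    have e2 : (fun r' : BinaryTree Unit => extPath (.node () l r')) =
        fun r' => (1 / 2 : ℝ) * extPath r' + (1 + extPath l / 2) := by
      ext; rw [extPath]; ring
    rw [insSum_node, e1, e2]
    simp only [insSum_add, insSum_const_mul, insSum_const, hl, hr, extPath, BinaryTree.numNodes]
    push_cast
    ring

theorem insSum_extPath_sq (t : BinaryTree Unit) :
    insSum (fun t => extPath t ^ 2) t =
      (t.numNodes + 1) * extPath t ^ 2 + 2 * extPath t + extQuad t := by
  induction t with
  | nil => simp [insSum, insAt, extPath, extQuad]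
  | node a l r hl hr =>
    have e1 : (fun l' : BinaryTree Unit => extPath (.node () l' r) ^ 2) =
        fun l' => (1 / 4 : ℝ) * extPath l' ^ 2 +
          ((1 + extPath r / 2) * extPath l' + (1 + extPath r / 2) ^ 2) := by
      ext; rw [extPath]; ring
    have e2 : (fun r' : BinaryTree Unit => extPath (.node () l r') ^ 2) =
        fun r' => (1 / 4 : ℝ) * extPath r' ^ 2 +
          ((1 + extPath l / 2) * extPath r' + (1 + extPath l / 2) ^ 2) := by
      ext; rw [extPath]; ring
    rw [insSum_node, e1, e2]
    simp only [insSum_add, insSum_const_mul, insSum_const, hl, hr, insSum_extPath, extPath,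
      extQuad, BinaryTree.numNodes]
    push_cast
    ring

theorem insSum_extQuad (t : BinaryTree Unit) :
    insSum extQuad t = (t.numNodes + 1) * extQuad t - extQuad t / 2 := by
  induction t with
  | nil => simp [insSum, insAt, extQuad]; norm_num
  | node a l r hl hr =>
    have e1 : (fun l' : BinaryTree Unit => extQuad (.node () l' r)) =
        fun l' => (1 / 4 : ℝ) * extQuad l' + extQuad r / 4 := by
      ext; rw [extQuad]; ring
    have e2 : (fun r' : BinaryTree Unit => extQuad (.node () l r')) =
        fun r' => (1 / 4 : ℝ) * extQuad r' + extQuad l / 4 := by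
      ext; rw [extQuad]; ring
    rw [insSum_node, e1, e2]
    simp only [insSum_add, insSum_const_mul, insSum_const, hl, hr, extQuad, BinaryTree.numNodes]
    push_cast
    ring

/-- The centered path length of a tree with `n` nodes. -/
noncomputable def centPath (n : ℕ) (t : BinaryTree Unit) : ℝ := extPath t - (harmonic n : ℚ)

theorem harmonic_succ_real (n : ℕ) :
    ((harmonic (n + 1) : ℚ) : ℝ) = (harmonic n : ℚ) + 1 / (n + 1) := by
  rw [harmonic_succ]; push_cast; simp

theorem insSum_centPath {n : ℕ} {t : BinaryTree Unit} (ht : t.numNodes = n) :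
    insSum (centPath (n + 1)) t = (n + 1) * centPath n t := by
  have e : centPath (n + 1) = fun t => extPath t + (-((harmonic (n + 1) : ℚ) : ℝ)) := by
    ext; rw [centPath]; ring
  have hn : (n + 1 : ℝ) ≠ 0 := by positivity
  rw [e, insSum_add, insSum_extPath, insSum_const, ht, centPath, harmonic_succ_real]
  field_simp
  ring

theorem treeMean_centPath (n : ℕ) : treeMean n (centPath n) = 0 := by
  induction n with
  | zero => simp [treeMean, centPath, extPath]
  | succ n ih =>
    rw [treeMean, treeMean_congr fun t ht => insSum_centPath ht, treeMean_const_mul, ih]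
    simp

theorem insSum_centPath_sq {n : ℕ} {t : BinaryTree Unit} (ht : t.numNodes = n) :
    insSum (fun t => centPath (n + 1) t ^ 2 + 2 * extQuad t) t =
      (n + 1) * (centPath n t ^ 2 + 2 * extQuad t) + -1 / (n + 1) := by
  have e : (fun t => centPath (n + 1) t ^ 2 + 2 * extQuad t) = fun t => extPath t ^ 2 +
      (-2 * ((harmonic (n + 1) : ℚ) : ℝ) * extPath t + (((harmonic (n + 1) : ℚ) : ℝ) ^ 2 +
        2 * extQuad t)) := by
    ext; rw [centPath]; ring
  have hn : (n + 1 : ℝ) ≠ 0 := by positivity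
  rw [e]
  simp only [insSum_add, insSum_const_mul, insSum_const, insSum_extPath, insSum_extPath_sq,
    insSum_extQuad, ht, centPath, harmonic_succ_real]
  field_simp
  ring

theorem treeMean_mono {n : ℕ} {f g : BinaryTree Unit → ℝ} (h : ∀ t, f t ≤ g t) :
    treeMean n f ≤ treeMean n g := by
  induction n generalizing f g with
  | zero => exact h _
  | succ n ih =>
    rw [treeMean, treeMean]
    gcongr
    exact ih fun t => Finset.sum_le_sum fun j _ => h _

theorem treeMean_centPath_sq_le (n : ℕ) : treeMean n (fun t => centPath n t ^ 2) ≤ 2 := by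
  have h : treeMean n (fun t => centPath n t ^ 2 + 2 * extQuad t) ≤ 2 := by
    induction n with
    | zero => simp [treeMean, centPath, extPath, extQuad]
    | succ n ih =>
      have hn : (0 : ℝ) < n + 1 := by positivity
      rw [treeMean, treeMean_congr fun t ht => insSum_centPath_sq ht, treeMean_add,
        treeMean_const_mul, treeMean_const, add_div, mul_div_cancel_left₀ _ hn.ne']
      have : -1 / ((n : ℝ) + 1) / (n + 1) ≤ 0 := by
        rw [div_div, neg_div]
        simp only [one_div, Left.neg_nonpos_iff]
        positivity
      linarith
  refine (treeMean_mono fun t => ?_).trans h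
  have := extQuad_nonneg t
  linarith

/-! ### Convergence of the path length in mean square -/

theorem integral_centPath_mul_eq {n m : ℕ} (h : n ≤ m) :
    ∫ x, centPath n (insSeq (relRank x) n) * centPath m (insSeq (relRank x) m) ∂unifSeq =
      ∫ x, centPath n (insSeq (relRank x) n) ^ 2 ∂unifSeq := by
  induction m, h using Nat.le_induction with
  | base => simp only [sq]
  | succ m hnm ih =>
    have hm : (m + 1 : ℝ) ≠ 0 := by positivity
    have hdep : ∀ f : BinaryTree Unit → ℝ,
        DependsOn (fun r => centPath n (insSeq r n) * f (insSeq r m)) (Set.Iio m) := by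
      intro f r r' hr
      simp only
      rw [insSeq_congr (r := r) (r' := r') (n := n) fun i hi => hr i (hi.trans_le hnm),
        insSeq_congr (r := r) (r' := r') (n := m) fun i hi => hr i hi]
    have := integral_relRank_succ (n := m)
      (fun j r => centPath n (insSeq r n) * centPath (m + 1) (insAt j (insSeq r m)))
      fun j => hdep fun t => centPath (m + 1) (insAt j t)
    rw [← ih, show (fun x => centPath n (insSeq (relRank x) n) *
      centPath (m + 1) (insSeq (relRank x) (m + 1))) = fun x => centPath n (insSeq (relRank x) n) *
      centPath (m + 1) (insAt (relRank x m) (insSeq (relRank x) m)) from rfl, this,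
      ← integral_finsetSum _ fun j _ =>
        (hdep fun t => centPath (m + 1) (insAt j t)).integrable_relRank, div_eq_iff hm,
      ← integral_mul_const]
    congr 1 with x
    have := insSum_centPath (numNodes_insSeq (relRank x) m)
    rw [insSum, numNodes_insSeq] at this
    rw [← Finset.mul_sum, this]
    ring

theorem exists_tendsto_of_inner_eq {E : Type*} [NormedAddCommGroup E] [InnerProductSpace ℝ E]
    [CompleteSpace E] {X : ℕ → E} (h : ∀ n m, n ≤ m → inner ℝ (X n) (X m) = ‖X n‖ ^ 2) {C : ℝ}
    (hC : ∀ n, ‖X n‖ ^ 2 ≤ C) : ∃ W, Tendsto X atTop (𝓝 W) := by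
  have hsub : ∀ n m, n ≤ m → ‖X m - X n‖ ^ 2 = ‖X m‖ ^ 2 - ‖X n‖ ^ 2 := by
    intro n m hnm
    rw [norm_sub_sq_real, real_inner_comm, h n m hnm]
    ring
  have hmono : Monotone fun n => ‖X n‖ ^ 2 := fun n m hnm => by
    have := hsub n m hnm
    have := sq_nonneg ‖X m - X n‖
    simp only
    linarith
  have hlim := tendsto_atTop_ciSup hmono ⟨C, by rintro _ ⟨n, rfl⟩; exact hC n⟩
  refine cauchySeq_tendsto_of_complete (Metric.cauchySeq_iff'.2 fun ε hε => ?_)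
  obtain ⟨N, hN⟩ := Metric.cauchySeq_iff'.1 hlim.cauchySeq (ε ^ 2) (by positivity)
  refine ⟨N, fun n hn => ?_⟩
  have := hN n hn
  rw [Real.dist_eq, ← hsub N n hn, abs_of_nonneg (sq_nonneg _)] at this
  rw [dist_eq_norm]
  exact lt_of_pow_lt_pow_left₀ 2 hε.le this

theorem exists_centered_limit_law : ∃ ν : Measure ℝ, IsProbabilityMeasure ν ∧
    MemLp (fun x : ℝ => x) 2 ν ∧ ∫ x, x ∂ν = 0 ∧
    ∀ s : ℝ, Tendsto (fun n => treeMean n fun t => Complex.exp (s * centPath n t * Complex.I))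
      atTop (𝓝 (charFun ν s)) := by
  set X : ℕ → (ℕ → ℝ) → ℝ := fun n x => centPath n (insSeq (relRank x) n) with hX
  have hXm : ∀ n, Measurable (X n) := fun n => (dependsOn_insSeq n (centPath n)).measurable_relRank
  have hXp : ∀ n, MemLp (X n) 2 unifSeq := fun n => by
    obtain ⟨C, hC⟩ := (dependsOn_insSeq n (centPath n)).exists_bound_relRank
    exact MemLp.of_bound (hXm n).aestronglyMeasurable C (ae_of_all _ hC)
  have hinner : ∀ {f g : (ℕ → ℝ) → ℝ} (hf : MemLp f 2 unifSeq) (hg : MemLp g 2 unifSeq),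
      inner ℝ (hf.toLp f) (hg.toLp g) = ∫ x, f x * g x ∂unifSeq := by
    intro f g hf hg
    rw [L2.inner_def]
    refine integral_congr_ae ?_
    filter_upwards [hf.coeFn_toLp, hg.coeFn_toLp] with x h1 h2
    simp [h1, h2, mul_comm]
  have hsq : ∀ n, ‖(hXp n).toLp (X n)‖ ^ 2 = ∫ x, X n x ^ 2 ∂unifSeq := fun n => by
    rw [← real_inner_self_eq_norm_sq, hinner]
    simp only [sq]
  obtain ⟨W, hW⟩ := exists_tendsto_of_inner_eq (X := fun n => (hXp n).toLp (X n)) (C := 2)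
    (fun n m hnm => by rw [hinner, hsq]; exact integral_centPath_mul_eq hnm)
    (fun n => by
      rw [hsq, hX, integral_insSeq_relRank n fun t => centPath n t ^ 2]
      exact treeMean_centPath_sq_le n)
  have hWp : MemLp W 2 unifSeq := Lp.memLp W
  have hWm : AEMeasurable W unifSeq := hWp.aestronglyMeasurable.aemeasurable
  have hprob : IsProbabilityMeasure (unifSeq.map W) := Measure.isProbabilityMeasure_map hWm
  refine ⟨unifSeq.map W, hprob, ?_, ?_, fun s => ?_⟩
  · exact (memLp_map_measure_iff (by fun_prop) hWm).2 hWp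
  · rw [integral_map hWm (by fun_prop)]
    have h1 : MemLp (fun _ : ℕ → ℝ => (1 : ℝ)) 2 unifSeq := memLp_const 1
    have hlim := (tendsto_const_nhds (x := h1.toLp _)).inner (𝕜 := ℝ) hW
    have h0 : ∀ n, inner ℝ (h1.toLp _) ((hXp n).toLp (X n)) = 0 := fun n => by
      rw [hinner]
      simp only [one_mul, hX]
      rw [integral_insSeq_relRank n (centPath n), treeMean_centPath]
    simp only [h0] at hlim
    have h2 := tendsto_nhds_unique hlim tendsto_const_nhds
    rw [← Lp.toLp_coeFn W hWp, hinner] at h2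
    simpa using h2
  · have hmeas := tendstoInMeasure_of_tendsto_Lp hW
    have hd : TendstoInDistribution X atTop W (fun _ => unifSeq) unifSeq := by
      refine TendstoInMeasure.tendstoInDistribution ?_ fun n => (hXm n).aemeasurable
      exact hmeas.congr (fun n => (hXp n).coeFn_toLp) EventuallyEq.rfl
    have hcf := ProbabilityMeasure.tendsto_iff_tendsto_charFun.1 hd.tendsto s
    refine hcf.congr fun n => ?_
    simp only [ProbabilityMeasure.coe_mk]
    rw [charFun_apply_real, integral_map (hXm n).aemeasurable (by fun_prop)]
    exact integral_insSeq_relRank n fun t => Complex.exp (s * centPath n t * Complex.I)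

/-! ### Riemann sums -/

/-- The joint characteristic function of `log (1 - ξ)` and `log ξ` for `ξ` uniform. -/
noncomputable def logCharFun (α β : ℝ) : ℂ :=
  ∫ u, Complex.exp ((α * Real.log (1 - u) + β * Real.log u : ℝ) * Complex.I) ∂unif

theorem integral_unif_eq_intervalIntegral (f : ℝ → ℂ) :
    ∫ u, f u ∂unif = ∫ u in (0 : ℝ)..1, f u := by
  rw [unif, integral_Icc_eq_integral_Ioc, intervalIntegral.integral_of_le zero_le_one]

theorem integral_floor (w : ℕ → ℂ) (n : ℕ) :
    ∫ u, w ⌊((n : ℝ) + 1) * u⌋₊ ∂unif = (∑ i ∈ Finset.range (n + 1), w i) / (n + 1) := by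
  have hn : (0 : ℝ) < n + 1 := by positivity
  have hae : ∀ i : ℕ, ∀ᵐ u ∂volume, u ∈ Set.uIoc ((i : ℝ) / (n + 1)) (((i + 1 : ℕ) : ℝ) / (n + 1)) →
      w i = w ⌊((n : ℝ) + 1) * u⌋₊ := by
    intro i
    filter_upwards [Measure.ae_ne volume (((i + 1 : ℕ) : ℝ) / (n + 1))] with u hu hmem
    rw [Set.uIoc_of_le (by gcongr; simp)] at hmem
    have h1 := (div_lt_iff₀ hn).1 hmem.1
    have h2 := (lt_div_iff₀ hn).1 (lt_of_le_of_ne hmem.2 hu)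
    congr 1
    have h0 : (0 : ℝ) ≤ i := by positivity
    rw [eq_comm, Nat.floor_eq_iff (by linarith)]
    push_cast at h2
    constructor <;> linarith
  have hint : ∀ i < n + 1, IntervalIntegrable (fun u => w ⌊((n : ℝ) + 1) * u⌋₊) volume
      ((i : ℝ) / (n + 1)) (((i + 1 : ℕ) : ℝ) / (n + 1)) := fun i _ =>
    (intervalIntegrable_const (c := w i)).congr_ae ((ae_restrict_iff' measurableSet_uIoc).2 (hae i))
  have hsum := intervalIntegral.sum_integral_adjacent_intervals
    (a := fun i : ℕ => (i : ℝ) / (n + 1)) (n := n + 1) hint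
  have h1 : ((n + 1 : ℕ) : ℝ) / (n + 1) = 1 := by push_cast; exact div_self hn.ne'
  rw [h1] at hsum
  simp only [Nat.cast_zero, zero_div] at hsum
  rw [integral_unif_eq_intervalIntegral, ← hsum, Finset.sum_div]
  refine Finset.sum_congr rfl fun i _ => ?_
  rw [← intervalIntegral.integral_congr_ae (hae i), intervalIntegral.integral_const]
  have : ((i + 1 : ℕ) : ℝ) / (n + 1) - i / (n + 1) = 1 / (n + 1) := by push_cast; ring
  rw [this, Complex.real_smul]
  push_cast
  ring

theorem tendsto_harmonic_sub_harmonic {j : ℕ → ℕ} {v : ℝ} (hv : 0 < v)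
    (hj : Tendsto (fun n => (j n : ℝ) / ((n : ℝ) + 1)) atTop (𝓝 v)) :
    Tendsto j atTop atTop ∧
    Tendsto (fun n => ((harmonic (j n) : ℚ) : ℝ) - (harmonic (n + 1) : ℚ)) atTop
      (𝓝 (Real.log v)) := by
  have hN : Tendsto (fun n : ℕ => (n : ℝ) + 1) atTop atTop :=
    tendsto_atTop_add_const_right _ _ tendsto_natCast_atTop_atTop
  have hjt : Tendsto j atTop atTop := by
    refine tendsto_natCast_atTop_iff.1 ((hj.pos_mul_atTop hv hN).congr fun n => ?_)
    have : (n : ℝ) + 1 ≠ 0 := by positivity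
    field_simp
  refine ⟨hjt, ?_⟩
  have h1 := Real.tendsto_harmonic_sub_log.comp hjt
  have h2 := Real.tendsto_harmonic_sub_log.comp (tendsto_add_atTop_nat 1)
  have h3 := (Real.continuousAt_log hv.ne').tendsto.comp hj
  have h4 := (h1.sub h2).add h3
  rw [sub_self, zero_add] at h4
  refine h4.congr' ?_
  filter_upwards [hjt.eventually_gt_atTop 0] with n hn
  have hjn : (j n : ℝ) ≠ 0 := by positivity
  have hn1 : (n : ℝ) + 1 ≠ 0 := by positivity
  simp only [Function.comp_apply, Real.log_div hjn hn1]
  push_cast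
  ring

/-- The limit of the averages that appear in the recursion for the characteristic functions. -/
theorem tendsto_antidiagonal_average {a b : ℕ → ℂ} {A B : ℂ} (ha : ∀ n, ‖a n‖ ≤ 1)
    (hb : ∀ n, ‖b n‖ ≤ 1) (hA : Tendsto a atTop (𝓝 A)) (hB : Tendsto b atTop (𝓝 B)) (α β : ℝ) :
    Tendsto (fun n : ℕ => (∑ p ∈ Finset.HasAntidiagonal.antidiagonal n, a p.1 * b p.2 *
      Complex.exp ((α * ((harmonic p.1 : ℚ) - (harmonic (n + 1) : ℚ)) +
        β * ((harmonic p.2 : ℚ) - (harmonic (n + 1) : ℚ)) : ℝ) * Complex.I)) / (n + 1))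
      atTop (𝓝 (A * B * logCharFun α β)) := by
  set w : ℕ → ℕ → ℂ := fun n j => a (n - j) * b j *
      Complex.exp ((α * ((harmonic (n - j) : ℚ) - (harmonic (n + 1) : ℚ)) +
        β * ((harmonic j : ℚ) - (harmonic (n + 1) : ℚ)) : ℝ) * Complex.I) with hw
  have hwn : ∀ n j, ‖w n j‖ ≤ 1 := fun n j => by
    rw [hw, norm_mul, norm_mul, Complex.norm_exp_ofReal_mul_I, mul_one]
    exact mul_le_one₀ (ha _) (norm_nonneg _) (hb _)
  have heq : ∀ n : ℕ, (∑ p ∈ Finset.HasAntidiagonal.antidiagonal n, a p.1 * b p.2 *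
      Complex.exp ((α * ((harmonic p.1 : ℚ) - (harmonic (n + 1) : ℚ)) +
        β * ((harmonic p.2 : ℚ) - (harmonic (n + 1) : ℚ)) : ℝ) * Complex.I)) / (n + 1) =
      ∫ u, w n ⌊((n : ℝ) + 1) * u⌋₊ ∂unif := by
    intro n
    rw [integral_floor, ← Finset.Nat.sum_antidiagonal_swap,
      Finset.Nat.sum_antidiagonal_eq_sum_range_succ_mk]
    rfl
  simp only [heq]
  rw [logCharFun, ← integral_const_mul]
  refine tendsto_integral_of_dominated_convergence (fun _ => 1) (fun n => ?_) (integrable_const _)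
    (fun n => ae_of_all _ fun u => hwn _ _) ?_
  · refine Measurable.aestronglyMeasurable ?_
    exact (measurable_of_countable (w n)).comp
      (Nat.measurable_floor.comp (measurable_const.mul measurable_id))
  have h01 : ∀ᵐ u ∂unif, u ∈ Set.Ioo (0 : ℝ) 1 := by
    rw [unif, ← Measure.restrict_congr_set Ioo_ae_eq_Icc]
    exact ae_restrict_mem measurableSet_Ioo
  filter_upwards [h01] with u hu
  have hN : Tendsto (fun n : ℕ => (n : ℝ) + 1) atTop atTop :=
    tendsto_atTop_add_const_right _ _ tendsto_natCast_atTop_atTop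
  have hfl : Tendsto (fun n : ℕ => (⌊((n : ℝ) + 1) * u⌋₊ : ℝ) / ((n : ℝ) + 1)) atTop (𝓝 u) := by
    refine ((tendsto_nat_floor_mul_div_atTop hu.1.le).comp hN).congr fun n => ?_
    simp [mul_comm]
  have hfl' : Tendsto (fun n : ℕ => ((n - ⌊((n : ℝ) + 1) * u⌋₊ : ℕ) : ℝ) / ((n : ℝ) + 1)) atTop
      (𝓝 (1 - u)) := by
    have h1 : Tendsto (fun n : ℕ => 1 - 1 / ((n : ℝ) + 1)) atTop (𝓝 (1 - 0)) :=
      tendsto_const_nhds.sub tendsto_one_div_add_atTop_nhds_zero_nat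
    rw [sub_zero] at h1
    refine (h1.sub hfl).congr fun n => ?_
    have hn : (0 : ℝ) < n + 1 := by positivity
    have hle : ⌊((n : ℝ) + 1) * u⌋₊ ≤ n := by
      refine Nat.lt_succ_iff.1 ((Nat.floor_lt (by nlinarith [hu.1])).2 ?_)
      push_cast
      nlinarith [hu.2]
    rw [Nat.cast_sub hle]
    field_simp
    ring
  obtain ⟨hj, hjH⟩ := tendsto_harmonic_sub_harmonic hu.1 hfl
  obtain ⟨hi, hiH⟩ := tendsto_harmonic_sub_harmonic (sub_pos.2 hu.2) hfl'
  refine ((hA.comp hi).mul (hB.comp hj)).mul ?_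
  refine (Complex.continuous_exp.tendsto _).comp (Tendsto.mul_const _ ?_)
  exact (Complex.continuous_ofReal.tendsto _).comp ((hiH.const_mul α).add (hjH.const_mul β))

/-! ### Limits of characteristic functions of additive tree functionals -/

/-- The characteristic function of a functional of a random binary search tree with `n` nodes,
centered by a multiple of the harmonic number. -/
noncomputable def centCharFun (F : BinaryTree Unit → ℝ) (σ : ℝ) (n : ℕ) : ℂ :=
  treeMean n fun t => Complex.exp ((F t - σ * (harmonic n : ℚ) : ℝ) * Complex.I)

theorem norm_centCharFun_le_one (F : BinaryTree Unit → ℝ) (σ : ℝ) (n : ℕ) :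
    ‖centCharFun F σ n‖ ≤ 1 := by
  rw [centCharFun, ← integral_insSeq_relRank]
  refine (norm_integral_le_of_norm_le_const (C := 1) (ae_of_all _ fun x => ?_)).trans_eq (by simp)
  rw [Complex.norm_exp_ofReal_mul_I]

theorem treeMean_exp_eq_centCharFun (F : BinaryTree Unit → ℝ) (σ : ℝ) (n : ℕ) :
    treeMean n (fun t => Complex.exp ((F t : ℝ) * Complex.I)) =
      Complex.exp ((σ * (harmonic n : ℚ) : ℝ) * Complex.I) * centCharFun F σ n := by
  rw [centCharFun, ← treeMean_const_mul]
  congr 1 with t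
  rw [← Complex.exp_add]
  congr 1
  push_cast
  ring

theorem centCharFun_succ {F A B : BinaryTree Unit → ℝ} {c : ℝ}
    (hF : ∀ l r, F (.node () l r) = c + A l + B r) (α β : ℝ) (n : ℕ) :
    centCharFun F (α + β) (n + 1) = Complex.exp (c * Complex.I) *
      ((∑ p ∈ Finset.HasAntidiagonal.antidiagonal n, centCharFun A α p.1 * centCharFun B β p.2 *
        Complex.exp ((α * ((harmonic p.1 : ℚ) - (harmonic (n + 1) : ℚ)) +
          β * ((harmonic p.2 : ℚ) - (harmonic (n + 1) : ℚ)) : ℝ) * Complex.I)) / (n + 1)) := by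
  have hn : (n + 1 : ℂ) ≠ 0 := by exact_mod_cast Nat.succ_ne_zero n
  have h1 : centCharFun F (α + β) (n + 1) = treeMean (n + 1) fun t =>
      Complex.exp ((c - (α + β) * (harmonic (n + 1) : ℚ) : ℝ) * Complex.I) *
        (Complex.exp ((A t.left : ℝ) * Complex.I) * Complex.exp ((B t.right : ℝ) * Complex.I)) := by
    refine treeMean_congr fun t ht => ?_
    cases t with
    | nil => simp at ht
    | node a l r =>
      rw [← Complex.exp_add, ← Complex.exp_add, hF]
      congr 1
      simp only [BinaryTree.left, BinaryTree.right]
      push_cast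
      ring
  have h2 := treeMean_left_mul_right (fun t => Complex.exp ((A t : ℝ) * Complex.I))
    (fun t => Complex.exp ((B t : ℝ) * Complex.I)) n
  rw [h1, treeMean_const_mul, eq_div_of_mul_eq hn ((mul_comm _ _).trans h2), mul_div_assoc',
    mul_div_assoc', Finset.mul_sum, Finset.mul_sum]
  congr 1
  refine Finset.sum_congr rfl fun p _ => ?_
  rw [treeMean_exp_eq_centCharFun A α, treeMean_exp_eq_centCharFun B β]
  have : Complex.exp ((c - (α + β) * (harmonic (n + 1) : ℚ) : ℝ) * Complex.I) *
      Complex.exp ((α * (harmonic p.1 : ℚ) : ℝ) * Complex.I) *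
      Complex.exp ((β * (harmonic p.2 : ℚ) : ℝ) * Complex.I) = Complex.exp (c * Complex.I) *
      Complex.exp ((α * ((harmonic p.1 : ℚ) - (harmonic (n + 1) : ℚ)) +
          β * ((harmonic p.2 : ℚ) - (harmonic (n + 1) : ℚ)) : ℝ) * Complex.I) := by
    rw [← Complex.exp_add, ← Complex.exp_add, ← Complex.exp_add]
    congr 1
    push_cast
    ring
  linear_combination (centCharFun A α p.1 * centCharFun B β p.2) * this

theorem tendsto_centCharFun {F A B : BinaryTree Unit → ℝ} {c α β : ℝ} {a b : ℂ}
    (hF : ∀ l r, F (.node () l r) = c + A l + B r)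
    (hA : Tendsto (centCharFun A α) atTop (𝓝 a)) (hB : Tendsto (centCharFun B β) atTop (𝓝 b)) :
    Tendsto (centCharFun F (α + β)) atTop
      (𝓝 (Complex.exp (c * Complex.I) * (a * b * logCharFun α β))) := by
  rw [← tendsto_add_atTop_iff_nat 1]
  simp only [centCharFun_succ hF α β]
  exact (tendsto_antidiagonal_average (norm_centCharFun_le_one A α)
    (norm_centCharFun_le_one B β) hA hB α β).const_mul _

/-! ### The limit law of the centered path length -/

theorem charFun_fixedPoint_map (ν : Measure ℝ) [IsProbabilityMeasure ν] (s : ℝ) :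
    charFun (((ν.prod ν).prod unif).map (fun p : (ℝ × ℝ) × ℝ =>
      (p.1.1 + p.1.2) / 2 + (1 + (Real.log p.2 + Real.log (1 - p.2)) / 2))) s =
      Complex.exp (s * Complex.I) *
        (charFun ν (s / 2) * charFun ν (s / 2) * logCharFun (s / 2) (s / 2)) := by
  rw [charFun_apply_real, integral_map (by fun_prop) (by fun_prop), charFun_apply_real,
    logCharFun, ← integral_prod_mul, ← integral_prod_mul, ← integral_const_mul]
  congr 1 with p
  simp only [← Complex.exp_add]
  congr 1
  push_cast
  ring

theorem norm_logCharFun_le_one (α β : ℝ) : ‖logCharFun α β‖ ≤ 1 := by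
  rw [logCharFun]
  refine (norm_integral_le_of_norm_le_const (C := 1) (ae_of_all _ fun x => ?_)).trans_eq (by simp)
  rw [Complex.norm_exp_ofReal_mul_I]

theorem IsEtaLaw.charFun_eq {ν : Measure ℝ} (h : IsEtaLaw ν) (s : ℝ) :
    charFun ν s = Complex.exp (s * Complex.I) *
      (charFun ν (s / 2) * charFun ν (s / 2) * logCharFun (s / 2) (s / 2)) := by
  have := h.isProbabilityMeasure
  rw [← charFun_fixedPoint_map, h.fixed]

theorem IsEtaLaw.hasDerivAt_charFun_zero {ν : Measure ℝ} (h : IsEtaLaw ν) :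
    HasDerivAt (charFun ν) 0 0 := by
  have := h.isProbabilityMeasure
  have h1 : MemLp id (1 : ℕ) ν := by
    rw [Nat.cast_one]
    exact h.memLp.mono_exponent (by norm_num)
  have hd : DifferentiableAt ℝ (charFun ν) 0 :=
    ((contDiff_charFun h1).differentiable (by norm_num)).differentiableAt
  have h2 := iteratedDeriv_charFun_zero h1
  rw [iteratedDeriv_one] at h2
  simp only [pow_one, h.mean_zero] at h2
  have h3 : deriv (charFun ν) 0 = 0 := by simpa using h2
  rw [← h3]
  exact hd.hasDerivAt

theorem IsEtaLaw.unique {ν ν' : Measure ℝ} (h : IsEtaLaw ν) (h' : IsEtaLaw ν') : ν = ν' := by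
  have := h.isProbabilityMeasure
  have := h'.isProbabilityMeasure
  refine Measure.ext_of_charFun (funext fun s => ?_)
  set d : ℝ → ℂ := fun s => charFun ν s - charFun ν' s with hd
  have hhalf : ∀ s, ‖d s‖ ≤ 2 * ‖d (s / 2)‖ := by
    intro s
    have e : d s = Complex.exp (s * Complex.I) * (d (s / 2) *
        (charFun ν (s / 2) + charFun ν' (s / 2)) * logCharFun (s / 2) (s / 2)) := by
      simp only [hd]
      rw [h.charFun_eq s, h'.charFun_eq s]
      ring
    rw [e, norm_mul, norm_mul, norm_mul, Complex.norm_exp_ofReal_mul_I, one_mul]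
    have h1 : ‖charFun ν (s / 2) + charFun ν' (s / 2)‖ ≤ 2 := by
      refine (norm_add_le _ _).trans ?_
      have := norm_charFun_le_one (μ := ν) (s / 2)
      have := norm_charFun_le_one (μ := ν') (s / 2)
      linarith
    calc _ ≤ ‖d (s / 2)‖ * 2 * 1 := by gcongr; exact norm_logCharFun_le_one _ _
      _ = _ := by ring
  have hpow : ∀ (m : ℕ) (s : ℝ), ‖d s‖ ≤ 2 ^ m * ‖d (s / 2 ^ m)‖ := by
    intro m
    induction m with
    | zero => simp
    | succ m ih =>
      intro s
      refine (ih s).trans ?_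
      have := hhalf (s / 2 ^ m)
      rw [div_div, ← pow_succ] at this
      calc _ ≤ 2 ^ m * (2 * ‖d (s / 2 ^ (m + 1))‖) := by gcongr
        _ = _ := by ring
  have hd0 : d 0 = 0 := by simp [hd]
  rcases eq_or_ne s 0 with rfl | hs
  · exact sub_eq_zero.1 hd0
  have hder : HasDerivAt d 0 0 := by
    have := h.hasDerivAt_charFun_zero.sub h'.hasDerivAt_charFun_zero
    rwa [sub_zero] at this
  have hseq : Tendsto (fun m : ℕ => s / 2 ^ m) atTop (𝓝[≠] 0) := by
    refine tendsto_nhdsWithin_iff.2 ⟨?_, Eventually.of_forall fun m => ?_⟩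
    · have := (tendsto_pow_atTop_nhds_zero_of_lt_one (r := (1 / 2 : ℝ)) (by norm_num)
        (by norm_num)).const_mul s
      simpa [div_eq_mul_inv] using this
    · simp [hs]
  have hlim := ((hder.tendsto_slope_zero.comp hseq).norm).const_mul |s|
  simp only [Function.comp_def, zero_add, hd0, sub_zero, norm_zero, mul_zero] at hlim
  have hle := ge_of_tendsto' hlim (b := ‖d s‖) fun m => by
    refine (hpow m s).trans_eq ?_
    rw [norm_smul, norm_inv, norm_div, Real.norm_eq_abs, norm_pow, Real.norm_ofNat]
    have : |s| ≠ 0 := abs_ne_zero.2 hs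
    field_simp
  exact sub_eq_zero.1 (norm_le_zero_iff.1 hle)

theorem centCharFun_mul_extPath (s : ℝ) (n : ℕ) :
    centCharFun (fun t => s * extPath t) s n =
      treeMean n fun t => Complex.exp (s * centPath n t * Complex.I) := by
  rw [centCharFun]
  congr 1 with t
  rw [centPath]
  congr 1
  push_cast
  ring

theorem exists_isEtaLaw : ∃ ν : Measure ℝ, IsEtaLaw ν ∧
    ∀ s : ℝ, Tendsto (centCharFun (fun t => s * extPath t) s) atTop (𝓝 (charFun ν s)) := by
  obtain ⟨ν, hp, hL, h0, hlim⟩ := exists_centered_limit_law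
  have hcf : ∀ s : ℝ, Tendsto (centCharFun (fun t => s * extPath t) s) atTop
      (𝓝 (charFun ν s)) := fun s => by
    refine (hlim s).congr fun n => ?_
    rw [centCharFun_mul_extPath]
  refine ⟨ν, ⟨hp, hL, h0, ?_⟩, hcf⟩
  have : IsProbabilityMeasure (((ν.prod ν).prod unif).map (fun p : (ℝ × ℝ) × ℝ =>
      (p.1.1 + p.1.2) / 2 + (1 + (Real.log p.2 + Real.log (1 - p.2)) / 2))) :=
    Measure.isProbabilityMeasure_map (by fun_prop)
  refine Measure.ext_of_charFun (funext fun s => ?_)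
  rw [charFun_fixedPoint_map]
  have h := tendsto_centCharFun (F := fun t => s * extPath t) (A := fun t => s / 2 * extPath t)
    (B := fun t => s / 2 * extPath t) (c := s) (fun l r => by rw [extPath]; ring)
    (hcf (s / 2)) (hcf (s / 2))
  rw [add_halves] at h
  exact tendsto_nhds_unique h (hcf s)

theorem existsUnique_isEtaLaw : ∃! ν : Measure ℝ, IsEtaLaw ν := by
  obtain ⟨ν, hν, -⟩ := exists_isEtaLaw
  exact ⟨ν, hν, fun ν' hν' => hν'.unique hν⟩

theorem IsEtaLaw.tendsto_centCharFun {ν : Measure ℝ} (h : IsEtaLaw ν) (s : ℝ) :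
    Tendsto (centCharFun (fun t => s * extPath t) s) atTop (𝓝 (charFun ν s)) := by
  obtain ⟨ν', hν', hlim⟩ := exists_isEtaLaw
  rw [h.unique hν']
  exact hlim s

/-! ### The limit of the dyadic increments -/

/-- The characteristic function of the vector of logarithmic path sums. -/
noncomputable def pathCharFun : (k : ℕ) → (Fin (2 ^ k) → ℝ) → ℂ
  | 0, _ => 1
  | k + 1, s => pathCharFun k (fun j => s (lowIdx j)) * pathCharFun k (fun j => s (highIdx j)) *
      logCharFun (∑ j : Fin (2 ^ k), s (lowIdx j)) (∑ j : Fin (2 ^ k), s (highIdx j))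

theorem IsEtaLaw.tendsto_centCharFun_dyadicPath {ν : Measure ℝ} (h : IsEtaLaw ν) (k : ℕ)
    (s : Fin (2 ^ k) → ℝ) :
    Tendsto (centCharFun (fun t => ∑ j, s j * dyadicPath k j t) (∑ j, s j)) atTop
      (𝓝 (Complex.exp ((k * ∑ j, s j : ℝ) * Complex.I) *
        (pathCharFun k s * ∏ j, charFun ν (s j)))) := by
  induction k with
  | zero =>
    have := h.tendsto_centCharFun (s 0)
    simpa [dyadicPath_zero, pathCharFun] using this
  | succ k ih =>
    have hstep := Silhouette.tendsto_centCharFun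
      (F := fun t => ∑ j, s j * dyadicPath (k + 1) j t) (c := ∑ j, s j)
      (fun l r => ?_) (ih fun j => s (lowIdx j)) (ih fun j => s (highIdx j))
    · rw [sum_dyadic_succ s, prod_dyadic_succ, pathCharFun]
      convert hstep using 2
      have e : Complex.exp ((((k + 1 : ℕ) : ℝ) * (∑ j : Fin (2 ^ k), s (lowIdx j) +
          ∑ j : Fin (2 ^ k), s (highIdx j)) : ℝ) * Complex.I) =
          Complex.exp ((∑ j, s j : ℝ) * Complex.I) *
          Complex.exp ((k * ∑ j : Fin (2 ^ k), s (lowIdx j) : ℝ) * Complex.I) *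
          Complex.exp ((k * ∑ j : Fin (2 ^ k), s (highIdx j) : ℝ) * Complex.I) := by
        rw [← Complex.exp_add, ← Complex.exp_add, sum_dyadic_succ s]
        congr 1
        push_cast
        ring
      rw [e]
      ring
    · rw [sum_dyadic_succ, sum_dyadic_succ s]
      simp only [dyadicPath_lowIdx, dyadicPath_highIdx, mul_add, mul_one, Finset.sum_add_distrib]
      ring

/-! ### The vector of logarithmic path sums -/

theorem comap_reindex_le {ι κ : Type*} (e : κ → ι) :
    MeasurableSpace.comap (fun (ω : ι → ℝ) i => ω (e i)) MeasurableSpace.pi ≤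
      ⨆ i ∈ Set.range e, MeasurableSpace.comap (fun ω : ι → ℝ => ω i) inferInstance := by
  refine measurable_iff_comap_le.1 ?_
  refine @measurable_pi_lambda _ _ _ (_) _ _ fun i => measurable_iff_comap_le.2 ?_
  exact le_iSup₂_of_le (e i) ⟨i, rfl⟩ le_rfl

theorem indepFun_infinitePi_of_disjoint {ι ι₁ ι₂ : Type*} {μ : ι → Measure ℝ}
    [∀ i, IsProbabilityMeasure (μ i)] {e₁ : ι₁ → ι} {e₂ : ι₂ → ι}
    (h : Disjoint (Set.range e₁) (Set.range e₂)) :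
    IndepFun (fun (ω : ι → ℝ) i => ω (e₁ i)) (fun (ω : ι → ℝ) i => ω (e₂ i))
      (Measure.infinitePi μ) := by
  have hi : iIndepFun (fun i (ω : ι → ℝ) => ω i) (Measure.infinitePi μ) :=
    iIndepFun_infinitePi (X := fun _ x => x) fun _ => measurable_id
  have hind := indep_iSup_of_disjoint (fun i => (measurable_pi_apply i).comap_le) hi.iIndep h
  rw [IndepFun_iff_Indep]
  exact indep_of_indep_of_le_left (indep_of_indep_of_le_right hind
    (comap_reindex_le e₂)) (comap_reindex_le e₁)

/-- The law of a family of independent uniform random variables indexed by words. -/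
noncomputable def unifWord : Measure (List Bool → ℝ) := Measure.infinitePi fun _ => unif

instance : IsProbabilityMeasure unifWord := by unfold unifWord; infer_instance

theorem integral_unifWord_cons (b : Bool) {f : (List Bool → ℝ) → ℂ} (hf : Measurable f) :
    ∫ ω, f (fun u => ω (b :: u)) ∂unifWord = ∫ ω, f ω ∂unifWord := by
  have h : unifWord.map (fun ω u => ω (b :: u)) = unifWord :=
    Measure.map_infinitePi_infinitePi_of_inj (P := fun _ : List Bool => unif) List.cons_injective
  conv_rhs => rw [← h]
  rw [integral_map (Measurable.aemeasurable (by fun_prop)) hf.aestronglyMeasurable]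

theorem integral_unifWord_mul {f : ℝ → ℂ} {g g' : (List Bool → ℝ) → ℂ} (hf : Measurable f)
    (hg : Measurable g) (hg' : Measurable g') :
    ∫ ω, f (ω []) * (g (fun u => ω (false :: u)) * g' fun u => ω (true :: u)) ∂unifWord =
      (∫ u, f u ∂unif) * ((∫ ω, g ω ∂unifWord) * ∫ ω, g' ω ∂unifWord) := by
  have h1 : IndepFun (fun (ω : List Bool → ℝ) (_ : Unit) => ω [])
      (fun (ω : List Bool → ℝ) (p : Bool × List Bool) => ω (p.1 :: p.2)) unifWord := by
    refine indepFun_infinitePi_of_disjoint (e₁ := fun _ : Unit => [])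
      (e₂ := fun p : Bool × List Bool => p.1 :: p.2) ?_
    rw [Set.disjoint_left]
    rintro _ ⟨_, rfl⟩ ⟨p, hp⟩
    simp at hp
  have h2 : IndepFun (fun (ω : List Bool → ℝ) (u : List Bool) => ω (false :: u))
      (fun (ω : List Bool → ℝ) (u : List Bool) => ω (true :: u)) unifWord := by
    refine indepFun_infinitePi_of_disjoint (e₁ := fun u : List Bool => false :: u)
      (e₂ := fun u : List Bool => true :: u) ?_
    rw [Set.disjoint_left]
    rintro _ ⟨u, rfl⟩ ⟨v, hv⟩
    simp at hv
  have e1 := h1.integral_fun_comp_mul_comp (f := fun v => f (v ()))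
    (g := fun v => g (fun u => v (false, u)) * g' fun u => v (true, u))
    (Measurable.aemeasurable (by fun_prop)) (Measurable.aemeasurable (by fun_prop))
    (Measurable.aestronglyMeasurable (by fun_prop)) (Measurable.aestronglyMeasurable (by fun_prop))
  have e2 := h2.integral_fun_comp_mul_comp (f := g) (g := g')
    (Measurable.aemeasurable (by fun_prop)) (Measurable.aemeasurable (by fun_prop))
    hg.aestronglyMeasurable hg'.aestronglyMeasurable
  rw [integral_unifWord_cons false hg, integral_unifWord_cons true hg'] at e2
  rw [← e2]
  refine e1.trans ?_
  congr 1
  have h : unifWord.map (fun ω => ω []) = unif :=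
    Measure.infinitePi_map_eval (fun _ : List Bool => unif) []
  rw [← h, integral_map (Measurable.aemeasurable (by fun_prop)) hf.aestronglyMeasurable]

@[fun_prop]
theorem measurable_pathLogSum (k : ℕ) : Measurable fun ω : List Bool → ℝ => pathLogSum k ω := by
  refine measurable_pi_iff.2 fun j => ?_
  unfold pathLogSum
  refine Finset.measurable_fun_sum _ fun l _ => ?_
  split_ifs <;> fun_prop

theorem measurable_exp_pathLogSum (k : ℕ) (s : Fin (2 ^ k) → ℝ) :
    Measurable fun ω : List Bool → ℝ =>
      Complex.exp ((∑ j, s j * pathLogSum k ω j : ℝ) * Complex.I) := by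
  have : ∀ j, Measurable fun ω : List Bool → ℝ => pathLogSum k ω j :=
    fun j => measurable_pi_iff.1 (measurable_pathLogSum k) j
  fun_prop

theorem integral_exp_pathLogSum (k : ℕ) (s : Fin (2 ^ k) → ℝ) :
    ∫ ω, Complex.exp ((∑ j, s j * pathLogSum k ω j : ℝ) * Complex.I) ∂unifWord =
      pathCharFun k s := by
  induction k with
  | zero => simp [pathLogSum, pathCharFun]
  | succ k ih =>
    have h := integral_unifWord_mul
      (f := fun u => Complex.exp (((∑ j : Fin (2 ^ k), s (lowIdx j)) * Real.log (1 - u) +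
        (∑ j : Fin (2 ^ k), s (highIdx j)) * Real.log u : ℝ) * Complex.I)) (by fun_prop)
      (measurable_exp_pathLogSum k fun j => s (lowIdx j))
      (measurable_exp_pathLogSum k fun j => s (highIdx j))
    rw [ih, ih, ← logCharFun] at h
    rw [pathCharFun, mul_comm, ← h]
    congr 1 with ω
    rw [← Complex.exp_add, ← Complex.exp_add, sum_dyadic_succ]
    congr 1
    simp only [pathLogSum_lowIdx, pathLogSum_highIdx, mul_add, Finset.sum_add_distrib,
      Finset.sum_mul]
    push_cast
    ring

/-! ### Convergence of the increments and of the path length -/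

/-- The centered means of the silhouette of a random binary search tree over dyadic intervals. -/
noncomputable def centDyadic (k n : ℕ) (r : ℕ → ℕ) : EuclideanSpace ℝ (Fin (2 ^ k)) :=
  WithLp.toLp 2 fun j => dyadicPath k j (insSeq r n) - (harmonic n : ℚ)

theorem measurable_centDyadic (k n : ℕ) : Measurable fun x => centDyadic k n (relRank x) := by
  refine (WithLp.measurable_toLp 2 _).comp (measurable_pi_iff.2 fun j => ?_)
  exact (dependsOn_insSeq n fun t => dyadicPath k j t - ((harmonic n : ℚ) : ℝ)).measurable_relRank

theorem charFun_centDyadic (k n : ℕ) (s : EuclideanSpace ℝ (Fin (2 ^ k))) :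
    charFun (unifSeq.map fun x => centDyadic k n (relRank x)) s =
      centCharFun (fun t => ∑ j, s j * dyadicPath k j t) (∑ j, s j) n := by
  rw [charFun_apply, integral_map (measurable_centDyadic k n).aemeasurable (by fun_prop),
    centCharFun, ← integral_insSeq_relRank]
  congr 1 with x
  congr 2
  simp only [PiLp.inner_apply, centDyadic, Finset.sum_mul, ← Finset.sum_sub_distrib]
  congr 1
  refine Finset.sum_congr rfl fun j _ => ?_
  simp
  ring

/-- The limit of the centered means over dyadic intervals. -/
noncomputable def dyadicLimit (k : ℕ) (ρ η : Fin (2 ^ k) → ℝ) : EuclideanSpace ℝ (Fin (2 ^ k)) :=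
  WithLp.toLp 2 fun j => k + ρ j + η j

theorem charFun_dyadicLimit {Ω' Ω'' : Type*} [MeasurableSpace Ω'] [MeasurableSpace Ω'']
    {P' : Measure Ω'} {P'' : Measure Ω''} {k : ℕ} {ν : Measure ℝ}
    {ξ : List Bool → Ω'' → ℝ} (hξ : ∀ u, HasLaw (ξ u) unif P'') (hξi : iIndepFun ξ P'')
    {ρ η : Fin (2 ^ k) → Ω' → ℝ}
    (hρ : IdentDistrib (fun ω j => ρ j ω) (fun ω j => pathLogSum k (fun u => ξ u ω) j) P' P'')
    (hη : ∀ j, HasLaw (η j) ν P') (hηi : iIndepFun η P')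
    (hρη : IndepFun (fun ω j => ρ j ω) (fun ω j => η j ω) P')
    (s : EuclideanSpace ℝ (Fin (2 ^ k))) :
    charFun (P'.map fun ω => dyadicLimit k (fun j => ρ j ω) fun j => η j ω) s =
      Complex.exp ((k * ∑ j, s j : ℝ) * Complex.I) *
        (pathCharFun k (fun j => s j) * ∏ j, charFun ν (s j)) := by
  have hρm : AEMeasurable (fun ω j => ρ j ω) P' := hρ.aemeasurable_fst
  have hηm : AEMeasurable (fun ω j => η j ω) P' :=
    aemeasurable_pi_iff.2 fun j => (hη j).aemeasurable
  have hρm' : ∀ j, AEMeasurable (fun ω => ρ j ω) P' := aemeasurable_pi_iff.1 hρm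
  have hηm' : ∀ j, AEMeasurable (fun ω => η j ω) P' := aemeasurable_pi_iff.1 hηm
  have hm : AEMeasurable (fun ω => dyadicLimit k (fun j => ρ j ω) fun j => η j ω) P' := by
    refine (WithLp.measurable_toLp 2 _).comp_aemeasurable (aemeasurable_pi_iff.2 fun j => ?_)
    exact ((hρm' j).const_add _).add (hηm' j)
  have h1 : ∫ ω, Complex.exp ((∑ j, s j * ρ j ω : ℝ) * Complex.I) ∂P' =
      pathCharFun k fun j => s j := by
    have hu : Measurable fun v : Fin (2 ^ k) → ℝ =>
      Complex.exp ((∑ j, s j * v j : ℝ) * Complex.I) := by fun_prop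
    have hlaw : HasLaw (fun ω u => ξ u ω) unifWord P'' :=
      hξi.hasLaw_infinitePi hξ (aemeasurable_pi_iff.2 fun u => (hξ u).aemeasurable)
    refine (hρ.comp hu).integral_eq.trans ?_
    rw [← integral_exp_pathLogSum, ← hlaw.map_eq, integral_map hlaw.aemeasurable
      (measurable_exp_pathLogSum k _).aestronglyMeasurable]
    rfl
  have h2 : ∫ ω, Complex.exp ((∑ j, s j * η j ω : ℝ) * Complex.I) ∂P' =
      ∏ j, charFun ν (s j) := by
    have := iIndepFun.integral_fun_prod_comp (𝓧 := fun _ => ℝ) (X := η)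
      (f := fun j (v : ℝ) => Complex.exp (s j * v * Complex.I)) hηi hηm'
      (fun j => Measurable.aestronglyMeasurable (by fun_prop))
    have e : ∀ ω, Complex.exp ((∑ j, s j * η j ω : ℝ) * Complex.I) =
        ∏ j, Complex.exp (s j * η j ω * Complex.I) := fun ω => by
      rw [← Complex.exp_sum, ← Finset.sum_mul]
      push_cast
      rfl
    simp only [e]
    rw [this]
    refine Finset.prod_congr rfl fun j _ => ?_
    rw [charFun_apply_real, ← (hη j).map_eq, integral_map (hη j).aemeasurable
      (Measurable.aestronglyMeasurable (by fun_prop))]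
  have h3 := hρη.integral_fun_comp_mul_comp
    (f := fun v : Fin (2 ^ k) → ℝ => Complex.exp ((∑ j, s j * v j : ℝ) * Complex.I))
    (g := fun v : Fin (2 ^ k) → ℝ => Complex.exp ((∑ j, s j * v j : ℝ) * Complex.I)) hρm hηm
    (Measurable.aestronglyMeasurable (by fun_prop)) (Measurable.aestronglyMeasurable (by fun_prop))
  simp only [h1, h2] at h3
  rw [← h3, charFun_apply, integral_map hm (by fun_prop), ← integral_const_mul]
  congr 1 with ω
  rw [← Complex.exp_add, ← Complex.exp_add]
  congr 1
  rw [← add_mul, ← add_mul, ← Complex.ofReal_add, ← Complex.ofReal_add]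
  congr 2
  simp only [PiLp.inner_apply, dyadicLimit, Finset.mul_sum, ← Finset.sum_add_distrib]
  refine Finset.sum_congr rfl fun j _ => ?_
  simp
  ring

/-- The map from the means over dyadic intervals to the normalized increments and the total
mean. -/
noncomputable def incrMean (k : ℕ) (v : EuclideanSpace ℝ (Fin (2 ^ k))) :
    (Fin (2 ^ k) → ℝ) × ℝ :=
  (fun j => (v j - (∑ i, v i) / 2 ^ k) / 2 ^ k, (∑ i, v i) / 2 ^ k)

theorem continuous_incrMean (k : ℕ) : Continuous (incrMean k) := by
  unfold incrMean
  fun_prop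

theorem incrMean_centDyadic (k n : ℕ) (x : ℕ → ℝ) :
    incrMean k (centDyadic k n (relRank x)) =
      (dyadicIncr k (normSilhouette (bst x n)), centeredPathLength (bst x n)) := by
  have hs : (∑ i, (dyadicPath k i (insSeq (relRank x) n) - ((harmonic n : ℚ) : ℝ))) / 2 ^ k =
      extPath (insSeq (relRank x) n) - ((harmonic n : ℚ) : ℝ) := by
    rw [Finset.sum_sub_distrib, sum_dyadicPath]
    simp
    field_simp
  rw [incrMean]
  simp only [centDyadic, hs, bst]
  refine Prod.ext (funext fun j => ?_) ?_
  · simp only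
    rw [dyadicIncr_normSilhouette, ← map_bstLabeled, extPath_map, dyadicPath_map]
    ring
  · simp only
    rw [centeredPathLength_shape, numNodes_bstLabeled, ← map_bstLabeled, extPath_map]

theorem incrMean_dyadicLimit (k : ℕ) (ρ η : Fin (2 ^ k) → ℝ) :
    incrMean k (dyadicLimit k ρ η) = (incrLimit k ρ η, etaLimit k ρ η) :=
  rfl

end Silhouette

theorem theorem4
    {Ω Ω' Ω'' : Type*} [MeasurableSpace Ω] [MeasurableSpace Ω'] [MeasurableSpace Ω'']
    (P : Measure Ω) [IsProbabilityMeasure P] (P' : Measure Ω') [IsProbabilityMeasure P']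
    (P'' : Measure Ω'') [IsProbabilityMeasure P'']
    -- the input of the BST algorithm
    (x : ℕ → Ω → ℝ) (hx_law : ∀ n, HasLaw (x n) Silhouette.unif P) (hx_indep : iIndepFun x P)
    (k : ℕ) :
    (∃! ν : Measure ℝ, Silhouette.IsEtaLaw ν) ∧
    ∀ ν : Measure ℝ, Silhouette.IsEtaLaw ν →
    ∀ (ξ : List Bool → Ω'' → ℝ), (∀ u, HasLaw (ξ u) Silhouette.unif P'') → iIndepFun ξ P'' →
    ∀ (ρ η : Fin (2 ^ k) → Ω' → ℝ),
      IdentDistrib (fun ω j => ρ j ω)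
        (fun ω j => Silhouette.pathLogSum k (fun u => ξ u ω) j) P' P'' →
      (∀ j, HasLaw (η j) ν P') → iIndepFun η P' →
      IndepFun (fun ω j => ρ j ω) (fun ω j => η j ω) P' →
      TendstoInDistribution
        (fun (n : ℕ) (ω : Ω) =>
          ((Silhouette.dyadicIncr k
              (Silhouette.normSilhouette (Silhouette.bst (fun i => x i ω) n)),
            Silhouette.centeredPathLength (Silhouette.bst (fun i => x i ω) n)) :
            (Fin (2 ^ k) → ℝ) × ℝ))
        atTop
        (fun ω : Ω' =>
          (Silhouette.incrLimit k (fun j => ρ j ω) (fun j => η j ω),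
            Silhouette.etaLimit k (fun j => ρ j ω) (fun j => η j ω)))
        (fun _ => P) P' := by
  refine ⟨Silhouette.existsUnique_isEtaLaw, ?_⟩
  intro ν hν ξ hξ hξi ρ η hρ hη hηi hρη
  have hlaw : HasLaw (fun ω i => x i ω) Silhouette.unifSeq P :=
    hx_indep.hasLaw_infinitePi hx_law (aemeasurable_pi_iff.2 fun i => (hx_law i).aemeasurable)
  have hXm : ∀ n, AEMeasurable
      (fun ω => Silhouette.centDyadic k n (Silhouette.relRank fun i => x i ω)) P := fun n =>
    (Silhouette.measurable_centDyadic k n).comp_aemeasurable hlaw.aemeasurable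
  have hZm : AEMeasurable
      (fun ω => Silhouette.dyadicLimit k (fun j => ρ j ω) fun j => η j ω) P' := by
    refine (WithLp.measurable_toLp 2 _).comp_aemeasurable (aemeasurable_pi_iff.2 fun j => ?_)
    exact ((aemeasurable_pi_iff.1 hρ.aemeasurable_fst j).const_add _).add (hη j).aemeasurable
  have hconv : TendstoInDistribution
      (fun n ω => Silhouette.centDyadic k n (Silhouette.relRank fun i => x i ω)) atTop
      (fun ω => Silhouette.dyadicLimit k (fun j => ρ j ω) fun j => η j ω) (fun _ => P) P' := by
    refine ⟨hXm, hZm, ProbabilityMeasure.tendsto_of_tendsto_charFun fun s => ?_⟩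
    simp only [ProbabilityMeasure.coe_mk]
    rw [Silhouette.charFun_dyadicLimit hξ hξi hρ hη hηi hρη]
    refine (hν.tendsto_centCharFun_dyadicPath k fun j => s j).congr fun n => ?_
    rw [← Silhouette.charFun_centDyadic, ← hlaw.map_eq,
      AEMeasurable.map_map_of_aemeasurable
        (Silhouette.measurable_centDyadic k n).aemeasurable hlaw.aemeasurable]
    rfl
  refine (hconv.continuous_comp (Silhouette.continuous_incrMean k)).congr
    (fun n => ae_of_all _ fun ω => ?_) (ae_of_all _ fun ω => ?_)
  · exact Silhouette.incrMean_centDyadic k n fun i => x i ω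
  · exact Silhouette.incrMean_dyadicLimit k _ _
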